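/- Let $k$ be a commutative ring containing $\mathbb{Q}$ and let $X=\{x_1,x_2,\dots\}$. A weak composition is a finite vector $\alpha=(\alpha_1,\dots,\alpha_r)$ of nonnegative integers; it is left weak if it is empty or $\alpha_r>0$. For left weak $\alpha$ put $M_\alpha=\sum_{i_1<\cdots<i_r}x_{i_1}^{\alpha_1}\cdots x_{i_r}^{\alpha_r}\in k[[X]]$; let $\mathrm{LWQSym}\subseteq k[[X]]$ be the $k$-span of these series and let $\mathrm{LWQSym}[t,x]\subseteq k[[X]][t,x]$ be the set of polynomials in $t,x$ with coefficients in $\mathrm{LWQSym}$. For a weak composition $\alpha$ and positive integers $\beta=(\beta_1,\dots,\beta_r)$ let $\phi(\alpha,\beta)\in k[[X]][t]((z))$ be the Laurent expansion at $z=0$ of $$\sum_{i_1<\cdots<i_r}x_{i_1}^{\alpha_1}\cdots x_{i_r}^{\alpha_r}\,e^{(i_1+t)\beta_1z}\cdots e^{(i_r+t)\beta_rz}\qquad(\operatorname{Re}z<0).$$ Write $w=(\alpha,\beta)$ as a word in the pairs $(\alpha_i,\beta_i)$, and let $\pi$ be the projection of Laurent series in $z$ onto their polar part. Put $\phi_\pm(\emptyset)=1$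 and, for $w\neq\emptyset$, $\bar\phi(w)=\phi(w)+\sum_{w=uv,\,u,v\ne\emptyset}\phi(u)\phi_-(v)$, $\phi_-(w)=-\pi(\bar\phi(w))$, $\phi_+(w)=\bar\phi(w)-\pi(\bar\phi(w))$. The renormalized monomial quasisymmetric function of an arbitrary weak composition $\alpha$ is $M_\alpha=\phi_+(\alpha,(\delta,\dots,\delta))|_{z=0}\in k[[X]][t]$, where $\delta$ is a positive integer. Let $QS(\mathbb{N})$ be the free $k$-module on the weak compositions with the quasi-shuffle product (with unit $\emptyset$) $$(a)\cdot u * (b)\cdot v=(a)\cdot(u*(b)\cdot v)+(b)\cdot((a)\cdot u*v)+(a+b)\cdot(u*v),$$ where $\cdot$ is concatenation, and let $Ш(k[x])=k[x]\otimes_k QS(\mathbb{N})$ with the operator $P(x^n\otimes\alpha)=1\otimes(n)\cdot\alpha$, which is the free commutative Rota–Baxter $k$-algebra of weight $1$ on the generator $x$. Then $\mathrm{LWQSym}[t,x]$ is a subalgebra of $k[[X]][t,x]$. The elements $x^nM_\alpha$ ($n\ge 0$, $\alpha$ a weak composition) do not depend on $\delta$ and form a $k$-basis of it, and $x^n\otimes\alpha\mapsto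 x^nM_\alpha$ defines an isomorphism of $k$-algebras $Ш(k[x])\cong\mathrm{LWQSym}[t,x]$. The operator that $P$ induces on $\mathrm{LWQSym}[t,x]$ is a Rota–Baxter operator of weight $1$ and sends $x^nM_\alpha$ to $M_{(n)\cdot\alpha}$. -/

import Mathlib

open scoped Polynomial TensorProduct

noncomputable section

namespace WCQSym

/-! ### The quasi-shuffle algebra of weak compositions

A weak composition is a finite list of natural numbers. -/

section QuasiShuffle

variable {k : Type*} [CommRing k]

/-- The linear operator `α ↦ (a) · α` on linear combinations of weak compositions, prepending
the component `a`. -/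
def consL (a : ℕ) : (List ℕ →₀ k) →ₗ[k] (List ℕ →₀ k) := Finsupp.lmapDomain k k (List.cons a)

/-- The quasi-shuffle product of two weak compositions. -/
def wmul : List ℕ → List ℕ → (List ℕ →₀ k)
  | [], v => Finsupp.single v 1
  | a :: u, [] => Finsupp.single (a :: u) 1
  | a :: u, b :: v =>
      consL a (wmul u (b :: v)) + consL b (wmul (a :: u) v) + consL (a + b) (wmul u v)
  termination_by u v => u.length + v.length

/-- The quasi-shuffle product, extended bilinearly. -/
def mulL : (List ℕ →₀ k) →ₗ[k] (List ℕ →₀ k) →ₗ[k] (List ℕ →₀ k) :=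
  Finsupp.lsum k fun u => LinearMap.toSpanSingleton k _
    (Finsupp.lsum k fun v => LinearMap.toSpanSingleton k _ (wmul u v))

lemma consL_single (a : ℕ) (α : List ℕ) (c : k) :
    consL a (Finsupp.single α c) = Finsupp.single (a :: α) c := by
  simp [consL]

lemma mulL_single (u v : List ℕ) :
    mulL (Finsupp.single u (1 : k)) (Finsupp.single v 1) = wmul u v := by
  simp [mulL]

lemma induction_word {p : (List ℕ →₀ k) → Prop} (h0 : p 0)
    (hadd : ∀ x y, p x → p y → p (x + y))
    (hs : ∀ (c : k) (u : List ℕ), p (c • Finsupp.single u 1)) (x : List ℕ →₀ k) : p x := by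
  refine Finsupp.induction_linear (motive := p) x h0 hadd fun u c => ?_
  simpa using hs c u

lemma wmul_nil_right (u : List ℕ) : (wmul u [] : List ℕ →₀ k) = Finsupp.single u 1 := by
  cases u <;> simp [wmul]

lemma wmul_comm (u v : List ℕ) : (wmul u v : List ℕ →₀ k) = wmul v u := by
  induction u generalizing v with
  | nil => rw [wmul_nil_right, wmul]
  | cons a u ihu =>
    induction v with
    | nil => rw [wmul_nil_right, wmul]
    | cons b v ihv =>
      rw [wmul, wmul, ihu, ihv, ihu, Nat.add_comm a b]
      abel

lemma mulL_consL (a b : ℕ) (x y : List ℕ →₀ k) :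
    mulL (consL a x) (consL b y) = consL a (mulL x (consL b y)) +
      consL b (mulL (consL a x) y) + consL (a + b) (mulL x y) := by
  induction x using induction_word with
  | h0 => simp
  | hadd x x' hx hx' =>
    simp only [map_add, LinearMap.add_apply, hx, hx']
    abel
  | hs c u =>
    induction y using induction_word with
    | h0 => simp
    | hadd y y' hy hy' =>
      simp only [map_add, hy, hy']
      abel
    | hs d v =>
      simp only [map_smul, LinearMap.smul_apply, consL_single, mulL_single, ← smul_add]
      rw [wmul]

lemma mulL_nil_left (y : List ℕ →₀ k) : mulL (Finsupp.single [] 1) y = y := by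
  induction y using induction_word with
  | h0 => simp
  | hadd y y' hy hy' => rw [map_add, hy, hy']
  | hs d v => rw [map_smul, mulL_single, wmul]

lemma mulL_comm (x y : List ℕ →₀ k) : mulL x y = mulL y x := by
  induction x using induction_word with
  | h0 => simp
  | hadd x x' hx hx' => rw [map_add, map_add, LinearMap.add_apply, hx, hx']
  | hs c u =>
    induction y using induction_word with
    | h0 => simp
    | hadd y y' hy hy' => rw [map_add, map_add, LinearMap.add_apply, hy, hy']
    | hs d v =>
      simp only [map_smul, LinearMap.smul_apply, mulL_single]
      rw [wmul_comm, smul_comm]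

lemma mulL_assoc_single : ∀ (n : ℕ) (u v w : List ℕ), u.length + v.length + w.length ≤ n →
    mulL (mulL (Finsupp.single u (1 : k)) (Finsupp.single v 1)) (Finsupp.single w 1) =
      mulL (Finsupp.single u 1) (mulL (Finsupp.single v 1) (Finsupp.single w 1)) := by
  intro n
  induction n with
  | zero =>
    intro u v w h
    have hu : u = [] := List.length_eq_zero_iff.1 (by omega)
    subst hu
    rw [mulL_nil_left, mulL_nil_left]
  | succ n ih =>
    intro u v w h
    match u, v, w with
    | [], v, w => rw [mulL_nil_left, mulL_nil_left]
    | a :: u, [], w => rw [mulL_comm (Finsupp.single (a :: u) 1), mulL_nil_left, mulL_nil_left]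
    | a :: u, b :: v, [] =>
      rw [mulL_comm _ (Finsupp.single [] 1), mulL_comm _ (Finsupp.single [] 1),
        mulL_nil_left, mulL_nil_left]
    | a :: u, b :: v, c :: w =>
      simp only [List.length_cons] at h
      have i1 := ih u (b :: v) (c :: w) (by simp; omega)
      have i2 := ih (a :: u) v (c :: w) (by simp; omega)
      have i3 := ih (a :: u) (b :: v) w (by simp; omega)
      have i4 := ih u v (c :: w) (by simp; omega)
      have i5 := ih u (b :: v) w (by simp; omega)
      have i6 := ih (a :: u) v w (by simp; omega)
      have i7 := ih u v w (by omega)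
      simp only [← consL_single] at i1 i2 i3 i4 i5 i6 i7 ⊢
      rw [mulL_consL b c] at i1
      rw [mulL_consL a b] at i3
      rw [mulL_consL a b, mulL_consL b c]
      simp only [map_add, LinearMap.add_apply] at i1 i3 ⊢
      rw [mulL_consL a c, mulL_consL b c, mulL_consL (a + b) c, mulL_consL a b, mulL_consL a c,
        mulL_consL a (b + c), i1, i2, i4, i5, i6, i7]
      have j3 := congrArg (consL c) i3
      simp only [map_add] at j3 ⊢
      rw [← j3, Nat.add_assoc]
      abel

lemma mulL_assoc (x y z : List ℕ →₀ k) : mulL (mulL x y) z = mulL x (mulL y z) := by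
  induction x using induction_word with
  | h0 => simp
  | hadd x x' hx hx' => simp only [map_add, LinearMap.add_apply, hx, hx']
  | hs c u =>
    induction y using induction_word with
    | h0 => simp
    | hadd y y' hy hy' => simp only [map_add, LinearMap.add_apply, hy, hy']
    | hs d v =>
      induction z using induction_word with
      | h0 => simp
      | hadd z z' hz hz' => simp only [map_add, hz, hz']
      | hs e w =>
        simp only [map_smul, LinearMap.smul_apply]
        rw [mulL_assoc_single _ u v w le_rfl]

end QuasiShuffle

/-- The quasi-shuffle algebra `QS(ℕ)`: the free `k`-module on the set of weak compositions,
with the quasi-shuffle product. -/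
def QS (k : Type*) [CommRing k] : Type _ := List ℕ →₀ k

namespace QS

variable {k : Type*} [CommRing k]

instance : AddCommGroup (QS k) := inferInstanceAs (AddCommGroup (List ℕ →₀ k))

instance : Module k (QS k) := inferInstanceAs (Module k (List ℕ →₀ k))

/-- The basis element of `QS k` given by a weak composition. -/
def word (α : List ℕ) : QS k := (Finsupp.single α 1 : List ℕ →₀ k)

/-- The linear operator `α ↦ (a) · α` on `QS k`. -/
def cons (a : ℕ) : QS k →ₗ[k] QS k := (consL a : (List ℕ →₀ k) →ₗ[k] (List ℕ →₀ k))

instance : CommRing (QS k) where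
  __ := (inferInstance : AddCommGroup (QS k))
  mul x y := mulL (k := k) x y
  one := word []
  mul_comm := mulL_comm (k := k)
  mul_assoc := mulL_assoc (k := k)
  one_mul := mulL_nil_left (k := k)
  mul_one x := (mulL_comm (k := k) x _).trans (mulL_nil_left (k := k) x)
  left_distrib x := map_add (mulL (k := k) x)
  right_distrib x y z := LinearMap.congr_fun (map_add (mulL (k := k)) x y) z
  zero_mul z := LinearMap.congr_fun (map_zero (mulL (k := k))) z
  mul_zero x := map_zero (mulL (k := k) x)

instance : Algebra k (QS k) :=
  Algebra.ofModule
    (fun r x y => LinearMap.congr_fun (map_smul (mulL (k := k)) r x) y)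
    (fun r x y => map_smul (mulL (k := k) x) r y)

end QS

/-! ### Rota-Baxter algebras -/

section RotaBaxter

variable {k : Type*} [CommRing k]

/-- `P` is a Rota-Baxter operator of weight `c` on the `k`-algebra `A`. -/
def IsRotaBaxter {A : Type*} [Semiring A] [Algebra k A] (c : k) (P : A →ₗ[k] A) : Prop :=
  ∀ x y : A, P x * P y = P (x * P y) + P (P x * y) + c • P (x * y)

/-- `(F, P)` is the free commutative (unital) Rota-Baxter `k`-algebra of weight `c` on the single
generator `x`. -/
def IsFreeCommRotaBaxter.{u, v, w} {k : Type u} [CommRing k] {F : Type v} [CommRing F]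
    [Algebra k F] (c : k) (P : F →ₗ[k] F) (x : F) : Prop :=
  IsRotaBaxter c P ∧
    ∀ (A : Type w) [CommRing A] [Algebra k A] (Q : A →ₗ[k] A), IsRotaBaxter c Q →
      ∀ a : A, ∃! f : F →ₐ[k] A, f x = a ∧ ∀ s : F, f (P s) = Q (f s)

variable (k) in
/-- The algebra `Ш(k[x]) = k[x] ⊗ Ш⁺(k[x])`, where the mixable shuffle algebra `Ш⁺(k[x])` of
weight `1` is the quasi-shuffle algebra of weak compositions, the word `(α₁, …, αₙ)` standing
for the tensor `x ^ α₁ ⊗ ⋯ ⊗ x ^ αₙ`. -/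
abbrev Sha : Type _ := k[X] ⊗[k] QS k

variable (k) in
/-- The operator `x ^ i ⊗ α ↦ 1 ⊗ (i) · α` on `Ш(k[x])`. -/
def shaP : Sha k →ₗ[k] Sha k :=
  TensorProduct.lift (Polynomial.lsum fun i =>
    LinearMap.toSpanSingleton k (QS k →ₗ[k] Sha k)
      (TensorProduct.mk k k[X] (QS k) 1 ∘ₗ QS.cons i))

lemma shaP_tmul (i : ℕ) (α : List ℕ) :
    shaP k ((Polynomial.X ^ i) ⊗ₜ[k] QS.word α) = 1 ⊗ₜ[k] QS.word (i :: α) := by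
  have h : QS.cons i (QS.word α : QS k) = QS.word (i :: α) := consL_single i α 1
  simp [shaP, Polynomial.lsum, ← h, Polynomial.X_pow_eq_monomial]

end RotaBaxter

/-! ### Left weak quasisymmetric functions -/

/-- The exponent of the monomial `x_{i₁} ^ α₁ ⋯ x_{iₙ} ^ αₙ`, where `I = (i₁, …, iₙ)`. -/
def expo (I : List ℕ+) (α : List ℕ) : ℕ+ →₀ ℕ := (List.zipWith Finsupp.single I α).sum

/-- The index set of the terms of `∑_{i₁ < ⋯ < iₙ} x_{i₁} ^ α₁ ⋯ x_{iₙ} ^ αₙ` that are equal to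
the monomial with exponent `m`. -/
abbrev Idx (α : List ℕ) (m : ℕ+ →₀ ℕ) : Type :=
  {I : List ℕ+ // I.Pairwise (· < ·) ∧ I.length = α.length ∧ expo I α = m}

/-- A weak composition is left weak if its last component is positive (or if it is empty). -/
def IsLeftWeak (α : List ℕ) : Prop := ∀ h : α ≠ [], 0 < α.getLast h

section Power

variable (k : Type*) [CommRing k]

/-- The monomial quasisymmetric function `∑_{i₁ < ⋯ < iₙ} x_{i₁} ^ α₁ ⋯ x_{iₙ} ^ αₙ`, meaningful
for a left weak composition `α` (then every `Idx α m` is finite). -/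
def monoQSym (α : List ℕ) : MvPowerSeries ℕ+ k := fun m => (Nat.card (Idx α m) : k)

/-- The `k`-module of left weak quasisymmetric functions. -/
def LWQSym : Submodule k (MvPowerSeries ℕ+ k) :=
  Submodule.span k (monoQSym k '' {α | IsLeftWeak α})

/-- `LWQSym[t, x]`: the elements of `k[[X]][t, x] = k[[X]][t][x]` all of whose coefficients lie
in `LWQSym`. -/
def LWQSymTX : Submodule k (MvPowerSeries ℕ+ k)[X][X] where
  carrier := {p | ∀ i j, (p.coeff i).coeff j ∈ LWQSym k}
  zero_mem' := by intro i j; simp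
  add_mem' := by
    intro p q hp hq i j
    simpa using Submodule.add_mem _ (hp i j) (hq i j)
  smul_mem' := by
    intro c p hp i j
    simpa using Submodule.smul_mem _ c (hp i j)

end Power

/-! ### Regularization

A weak composition `α` with a direction `β` (a vector of positive integers of the same length)
is the list of the pairs `(αᵢ, βᵢ)`. -/

/-- The coefficient of the monomial with exponent `m` in
`∑_{i₁ < ⋯ < iₙ} x_{i₁} ^ α₁ ⋯ x_{iₙ} ^ αₙ e ^ (i₁ β₁ z) ⋯ e ^ (iₙ βₙ z)`, for `Re z < 0`. -/
def regCoeff (w : List (ℕ × ℕ+)) (m : ℕ+ →₀ ℕ) (z : ℂ) : ℂ :=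
  ∑' I : Idx (w.map Prod.fst) m,
    Complex.exp
      (((List.zipWith (fun i b : ℕ+ => (i : ℂ) * (b : ℂ)) I.1 (w.map Prod.snd)).sum) * z)

/-- The function `f`, on the part of a neighbourhood of `0` where `Re z < 0`, is the sum of the
Laurent series `c`. -/
def IsLaurentExpansion (c : LaurentSeries ℚ) (f : ℂ → ℂ) : Prop :=
  ∃ r : ℝ, 0 < r ∧ ∀ z : ℂ, z.re < 0 → ‖z‖ < r →
    HasSum (fun n : ℤ => (c.coeff n : ℂ) * z ^ n) (f z)

open Classical in
/-- The (unique) Laurent expansion at `0` of a function on `Re z < 0`; by convention `0` if there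
is none. -/
def laurentExpansion (f : ℂ → ℂ) : LaurentSeries ℚ :=
  if h : ∃ c, IsLaurentExpansion c f then h.choose else 0

section Renormalization

variable (k : Type*) [CommRing k] [Algebra ℚ k]

/-- The regularization at `t = 0`, as an element of `k[[X]][t]((z))`. The pole orders in `z` of
the coefficients of all monomials are bounded by the length of `w`, so that the power series in
`X` with Laurent series coefficients becomes a Laurent series with power series coefficients. -/
def phiZero (w : List (ℕ × ℕ+)) : LaurentSeries (MvPowerSeries ℕ+ k)[X] :=
  HahnSeries.ofSuppBddBelow
    (fun n : ℤ => if -(w.length : ℤ) ≤ n then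
      Polynomial.C (fun m => algebraMap ℚ k ((laurentExpansion (regCoeff w m)).coeff n)) else 0)
    ⟨-(w.length : ℤ), by
      intro n hn
      by_contra h
      exact hn (if_neg h)⟩

/-- The power series `e ^ (b t z) = ∑ bⁿ tⁿ zⁿ / n!` in `z`, with coefficients in `k[[X]][t]`. -/
def expTZ (b : ℕ) : PowerSeries (MvPowerSeries ℕ+ k)[X] :=
  PowerSeries.mk fun n =>
    Polynomial.monomial n (algebraMap ℚ (MvPowerSeries ℕ+ k) ((b : ℚ) ^ n / n.factorial))

/-- The regularization
`φ(α, β) = ∑_{i₁ < ⋯ < iₙ} x_{i₁} ^ α₁ ⋯ x_{iₙ} ^ αₙ e ^ ((i₁ + t) β₁ z) ⋯ e ^ ((iₙ + t) βₙ z)`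
in `k[[X]][t]((z))`. The variable `t` enters through the common factor
`e ^ (t (β₁ + ⋯ + βₙ) z)` of the terms. -/
def phi (w : List (ℕ × ℕ+)) : LaurentSeries (MvPowerSeries ℕ+ k)[X] :=
  HahnSeries.ofPowerSeries ℤ _ (expTZ k (w.map fun p => (p.2 : ℕ)).sum) * phiZero k w

/-- The projection onto the polar part of a Laurent series. -/
def polar {R : Type*} [CommRing R] (c : LaurentSeries R) : LaurentSeries R :=
  HahnSeries.truncLT (0 : ℤ) c

/-- The component `φ₋` of the algebraic Birkhoff factorization `φ = φ₊ ⋆ φ₋^{⋆(-1)}` with respect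
to deconcatenation: `φ₋(w) = -P (φ(w) + ∑ φ(w') φ₋(w''))`, summed over the decompositions of `w`
into nonempty words `w'`, `w''`. -/
def phiMinus : List (ℕ × ℕ+) → LaurentSeries (MvPowerSeries ℕ+ k)[X]
  | [] => 1
  | p :: w => -polar (phi k (p :: w) +
      ∑ i : Fin w.length, phi k (p :: w.take i) * phiMinus (w.drop i))
  termination_by w => w.length
  decreasing_by simp

/-- The component `φ₊` of the algebraic Birkhoff factorization:
`φ₊(w) = (id - P) (φ(w) + ∑ φ(w') φ₋(w''))`. -/
def phiPlus : List (ℕ × ℕ+) → LaurentSeries (MvPowerSeries ℕ+ k)[X]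
  | [] => 1
  | p :: w =>
      let b := phi k (p :: w) +
        ∑ i : Fin w.length, phi k (p :: w.take i) * phiMinus k (w.drop i)
      b - polar b

/-- The directional quasisymmetric function: the value of `φ₊(α, β)` at `z = 0`. -/
def dirQSym (w : List (ℕ × ℕ+)) : (MvPowerSeries ℕ+ k)[X] := (phiPlus k w).coeff 0

/-- The renormalized monomial quasisymmetric function `M_α` in `k[[X]][t]`, computed in the
constant direction `(δ, …, δ)`. -/
def renQSym (δ : ℕ+) (α : List ℕ) : (MvPowerSeries ℕ+ k)[X] := dirQSym k (α.map fun a => (a, δ))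

end Renormalization

end WCQSym

end

universe u w

/-! Freeness is the classical statement: the quasi-shuffle recursion is the Rota-Baxter identity of
weight 1 read on words, and every word is an iterated application of `shaP`.

Everything else rests on one explicit formula, `IsRenormalized`. Write `α = v 0^m` with `v` left
weak. In a term of `M_v` equal to the monomial `μ`, the last index is the largest variable index
`top μ` of `μ`, so the trailing zeros only sum over `m` further indices beyond `top μ`. In the
variables `x_1, …, x_N` there are `binom(N - top μ, m)` choices; the formula says that
renormalization replaces this number by `binom(-t - 1/2 - top μ, m)`. Hence `t = -N - 1/2` turns
`M_α` into its truncation on all monomials in `x_1, …, x_N` (`IsRenormalized.coeff_eval`), and a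
polynomial in `t` is determined by infinitely many such `N`. Multiplicativity and linear
independence of the `M_α` thus come from the truncations (`extendL_chainSum_mul`,
`eq_zero_of_extendL_truncQSym`). The span of the `M_α` is `LWQSym[t]`: left weak words give the
generators of `LWQSym`, the word `(0)` gives `-t - 1/2`, and quasi-shuffle multiplication by `(0)`
produces further trailing zeros one at a time, up to division by integers. Adjoining `x` is formal.

For the formula, take the direction `(δ, …, δ)` and put `q = e^(δz)`. Geometric series show that the
trailing zeros contribute `e^(mδ(t + top μ)z) ∏_{i ≤ m} q^i / (1 - q^i)`. The product is the `m`-th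
elementary symmetric function of `q, q^2, …`, so Newton's identities make its generating series an
exponential whose exponent is linear in the power sums `q^i / (1 - q^i)`. The counterterms form a
similar exponential, built from `1 / (iδz)`. Convolution adds the exponents, which cancels all poles
and leaves the same constant `y = -t - top μ - 1/2` for every `i`; at `z = 0` the result is a
coefficient of `(1 + u)^y` (`exists_sum_prodGeo_mul_polarSeq`), and `δ` has disappeared. Uniqueness
of the splitting into polar and regular parts identifies this with the Birkhoff factorization
(`phiMinus_map`, `phiPlus_map`). -/

noncomputable section

namespace WCQSym

/-! ### Linear maps and homomorphisms out of `QS(ℕ)` -/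

section WordMaps

variable {k : Type*} [CommRing k] {A : Type*} [CommRing A] [Algebra k A]

/-- The linear extension of a function on weak compositions. -/
def extendL (h : List ℕ → A) : QS k →ₗ[k] A := Finsupp.linearCombination k h

lemma extendL_word (h : List ℕ → A) (α : List ℕ) : extendL h (QS.word α : QS k) = h α := by
  change Finsupp.linearCombination k h (Finsupp.single α 1) = h α
  simp

lemma cons_word (a : ℕ) (α : List ℕ) : QS.cons a (QS.word α : QS k) = QS.word (a :: α) :=
  consL_single a α 1

lemma QS.hom_ext {M : Type*} [AddCommGroup M] [Module k M] {f g : QS k →ₗ[k] M}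
    (h : ∀ α, f (QS.word α) = g (QS.word α)) : f = g :=
  Finsupp.lhom_ext' fun α => LinearMap.ext_ring (h α)

lemma word_nil : (QS.word [] : QS k) = 1 := rfl

lemma cons_mul_cons (a b : ℕ) (x y : QS k) :
    QS.cons a x * QS.cons b y = QS.cons a (x * QS.cons b y) + QS.cons b (QS.cons a x * y) +
      QS.cons (a + b) (x * y) :=
  mulL_consL a b x y

/-- A function on weak compositions that turns the quasi-shuffle product of words into the
product extends to an algebra homomorphism. -/
def liftHom (h : List ℕ → A) (h1 : h [] = 1)
    (hmul : ∀ u v, extendL h (QS.word u * QS.word v : QS k) = h u * h v) : QS k →ₐ[k] A :=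
  AlgHom.ofLinearMap (extendL h) (by rw [← word_nil, extendL_word, h1]) (by
    have : (LinearMap.mul k (QS k)).compr₂ (extendL h) =
        (LinearMap.mul k A).compl₁₂ (extendL h) (extendL h) := by
      refine QS.hom_ext fun u => QS.hom_ext fun v => ?_
      simp [hmul, extendL_word]
    intro x y
    exact LinearMap.congr_fun₂ this x y)

lemma liftHom_word (h : List ℕ → A) (h1 : h [] = 1)
    (hmul : ∀ u v, extendL h (QS.word u * QS.word v : QS k) = h u * h v) (α : List ℕ) :
    liftHom h h1 hmul (QS.word α) = h α := extendL_word h α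

end WordMaps

/-! ### The free commutative Rota-Baxter algebra on one generator -/

section Free

variable {k : Type*} [CommRing k]

lemma shaP_X_pow_tmul (i : ℕ) (u : QS k) :
    shaP k ((Polynomial.X ^ i) ⊗ₜ[k] u) = 1 ⊗ₜ[k] QS.cons i u := by
  simp [shaP, Polynomial.lsum, Polynomial.X_pow_eq_monomial]

lemma sha_hom_ext {M : Type*} [AddCommGroup M] [Module k M] {f g : Sha k →ₗ[k] M}
    (h : ∀ (n : ℕ) (u : QS k), f ((Polynomial.X ^ n) ⊗ₜ u) = g ((Polynomial.X ^ n) ⊗ₜ u)) :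
    f = g := by
  refine TensorProduct.ext ?_
  refine Polynomial.lhom_ext' fun n => LinearMap.ext_ring ?_
  ext u
  simpa [Polynomial.X_pow_eq_monomial] using h n u

/-- Both sides are bilinear, and on `x^i ⊗ u` and `x^j ⊗ v` the identity is the quasi-shuffle
recursion for `(i) · u` and `(j) · v`. -/
theorem isRotaBaxter_shaP : IsRotaBaxter (1 : k) (shaP k) := by
  have : (LinearMap.mul k (Sha k)).compl₁₂ (shaP k) (shaP k) =
      ((LinearMap.mul k (Sha k)).compl₁₂ LinearMap.id (shaP k)).compr₂ (shaP k) +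
      ((LinearMap.mul k (Sha k)).compl₁₂ (shaP k) LinearMap.id).compr₂ (shaP k) +
      (LinearMap.mul k (Sha k)).compr₂ (shaP k) := by
    refine sha_hom_ext fun i u => sha_hom_ext fun j v => ?_
    simp only [LinearMap.compl₁₂_apply, LinearMap.mul_apply', LinearMap.add_apply,
      LinearMap.compr₂_apply, LinearMap.id_apply, shaP_X_pow_tmul,
      Algebra.TensorProduct.tmul_mul_tmul, mul_one, one_mul, ← pow_add, cons_mul_cons,
      TensorProduct.tmul_add]
  intro x y
  have h := LinearMap.congr_fun₂ this x y
  simpa using h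

variable {A : Type*} [CommRing A] [Algebra k A]

/-- The value on a word of the homomorphism from `QS(ℕ)` into a Rota-Baxter algebra. -/
def rbWord (Q : A →ₗ[k] A) (a : A) : List ℕ → A
  | [] => 1
  | i :: α => Q (a ^ i * rbWord Q a α)

lemma extendL_rbWord_cons (Q : A →ₗ[k] A) (a : A) (i : ℕ) (u : QS k) :
    extendL (rbWord Q a) (QS.cons i u) = Q (a ^ i * extendL (rbWord Q a) u) := by
  have : (extendL (rbWord Q a)) ∘ₗ (QS.cons i : QS k →ₗ[k] QS k) =
      Q ∘ₗ (LinearMap.mulLeft k (a ^ i)) ∘ₗ (extendL (rbWord Q a)) := by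
    refine QS.hom_ext fun α => ?_
    simp [cons_word, extendL_word, rbWord]
  exact LinearMap.congr_fun this u

/-- The Rota-Baxter identity for `Q` gives the product on the right the same three-term recursion as
the quasi-shuffle product, so induction on the total length applies. -/
lemma extendL_rbWord_mul (Q : A →ₗ[k] A) (hQ : IsRotaBaxter (1 : k) Q) (a : A) :
    ∀ (n : ℕ) (u v : List ℕ), u.length + v.length ≤ n →
      extendL (rbWord Q a) (QS.word u * QS.word v : QS k) = rbWord Q a u * rbWord Q a v := by
  intro n
  induction n with
  | zero =>
    intro u v h
    obtain rfl : u = [] := List.length_eq_zero_iff.1 (by omega)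
    rw [word_nil, one_mul, extendL_word, rbWord, one_mul]
  | succ n ih =>
    intro u v h
    match u, v with
    | [], v => rw [word_nil, one_mul, extendL_word, rbWord, one_mul]
    | u, [] => rw [word_nil, mul_one, extendL_word, rbWord, mul_one]
    | i :: u, j :: v =>
      simp only [List.length_cons] at h
      have i1 := ih u (j :: v) (by simp; omega)
      have i2 := ih (i :: u) v (by simp; omega)
      have i3 := ih u v (by omega)
      rw [← cons_word] at i1 i2
      rw [← cons_word, ← cons_word, cons_mul_cons, map_add, map_add, extendL_rbWord_cons,
        extendL_rbWord_cons, extendL_rbWord_cons, i1, i2, i3, rbWord, rbWord, hQ, one_smul]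
      congr 2
      · ring_nf
      · ring_nf
      · ring_nf

/-- Uniqueness holds because `1 ⊗ (i) · α` is the operator applied to `x^i ⊗ α`: a homomorphism that
commutes with the operators is forced on words by induction on their length, once the image of `x`
is known. -/
theorem isFreeCommRotaBaxter_shaP (k : Type u) [CommRing k] :
    IsFreeCommRotaBaxter.{u, u, w} (1 : k) (shaP k) ((Polynomial.X : k[X]) ⊗ₜ[k] (1 : QS k)) := by
  refine ⟨isRotaBaxter_shaP, fun A _ _ Q hQ a => ?_⟩
  let g : QS k →ₐ[k] A := liftHom (rbWord Q a) rfl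
    fun u v => extendL_rbWord_mul Q hQ a _ u v le_rfl
  let f : Sha k →ₐ[k] A := Algebra.TensorProduct.lift (Polynomial.aeval a) g
    fun x y => Commute.all _ _
  have hf : ∀ s, f (shaP k s) = Q (f s) := by
    have : f.toLinearMap ∘ₗ shaP k = Q ∘ₗ f.toLinearMap := by
      refine sha_hom_ext fun n u => ?_
      simp only [LinearMap.comp_apply, shaP_X_pow_tmul, AlgHom.toLinearMap_apply, f,
        Algebra.TensorProduct.lift_tmul, map_one, one_mul, map_pow, Polynomial.aeval_X]
      exact extendL_rbWord_cons Q a n u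
    exact LinearMap.congr_fun this
  refine ⟨f, ⟨by simp [f], hf⟩, ?_⟩
  rintro f' ⟨hx, hP⟩
  have hX : ∀ n : ℕ, ∀ u : QS k, ((Polynomial.X ^ n : k[X]) ⊗ₜ[k] u : Sha k) =
      ((Polynomial.X : k[X]) ⊗ₜ[k] (1 : QS k)) ^ n * (1 ⊗ₜ u) := by
    intro n u
    rw [Algebra.TensorProduct.tmul_pow, Algebra.TensorProduct.tmul_mul_tmul]
    simp
  have hfx : f ((Polynomial.X : k[X]) ⊗ₜ[k] (1 : QS k)) = a := by simp [f]
  have hw : ∀ α : List ℕ, f' (1 ⊗ₜ QS.word α) = f (1 ⊗ₜ QS.word α) := by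
    intro α
    induction α with
    | nil => rw [word_nil, ← Algebra.TensorProduct.one_def, map_one, map_one]
    | cons i α ih =>
      rw [← shaP_tmul, hP, hf, hX, map_mul f', map_mul f, map_pow f', map_pow f, hx, hfx, ih]
  have : f'.toLinearMap = f.toLinearMap := by
    refine sha_hom_ext fun n u => ?_
    have : f'.toLinearMap ∘ₗ TensorProduct.mk k k[X] (QS k) 1 =
        f.toLinearMap ∘ₗ TensorProduct.mk k k[X] (QS k) 1 := QS.hom_ext fun α => by simpa using hw α
    have := LinearMap.congr_fun this u
    simp only [LinearMap.comp_apply, TensorProduct.mk_apply, AlgHom.toLinearMap_apply] at this ⊢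
    rw [hX, map_mul, map_mul, map_pow, map_pow, hx, hfx, this]
  exact AlgHom.toLinearMap_injective this

end Free

/-! ### Monomial quasisymmetric functions of finite sequences -/

section ChainSum

variable {k : Type*} [CommRing k] {A : Type*} [CommRing A] [Algebra k A]

/-- The sum of the products `x₁ ^ α₁ ⋯ xᵣ ^ αᵣ` over the subsequences `x₁, …, xᵣ` of a sequence. -/
def chainSum : List A → List ℕ → A
  | _, [] => 1
  | [], _ :: _ => 0
  | x :: xs, a :: α => chainSum xs (a :: α) + x ^ a * chainSum xs α

lemma chainSum_nil_right (xs : List A) : chainSum xs [] = 1 := by cases xs <;> rfl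

lemma map_chainSum {B : Type*} [CommRing B] (f : A →+* B) (xs : List A) (α : List ℕ) :
    f (chainSum xs α) = chainSum (xs.map f) α := by
  induction xs generalizing α with
  | nil => cases α <;> simp [chainSum]
  | cons x xs ih => cases α <;> simp [chainSum, ih]

lemma extendL_chainSum_cons (x : A) (xs : List A) (a : ℕ) (u : QS k) :
    extendL (chainSum (x :: xs)) (QS.cons a u) =
      extendL (chainSum xs) (QS.cons a u) + x ^ a * extendL (chainSum xs) u := by
  have : extendL (chainSum (x :: xs)) ∘ₗ (QS.cons a : QS k →ₗ[k] QS k) =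
      extendL (chainSum xs) ∘ₗ QS.cons a +
        LinearMap.mulLeft k (x ^ a) ∘ₗ extendL (chainSum xs) := by
    refine QS.hom_ext fun α => ?_
    simp [cons_word, extendL_word, chainSum]
  exact LinearMap.congr_fun this u

lemma extendL_chainSum_nil_cons (a : ℕ) (u : QS k) :
    extendL (chainSum ([] : List A)) (QS.cons a u) = 0 := by
  have : extendL (chainSum ([] : List A)) ∘ₗ (QS.cons a : QS k →ₗ[k] QS k) = 0 := by
    refine QS.hom_ext fun α => ?_
    simp [cons_word, extendL_word, chainSum]
  exact LinearMap.congr_fun this u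

/-- Split off the first element `x`. In a product of two sums it is used by neither factor, by one
of them, or by both; the last three cases are the three terms of the quasi-shuffle recursion, with
`x^(a + b)` from the common use. -/
theorem extendL_chainSum_mul (xs : List A) (u v : List ℕ) :
    extendL (chainSum xs) (QS.word u * QS.word v : QS k) = chainSum xs u * chainSum xs v := by
  induction xs generalizing u v with
  | nil =>
    match u, v with
    | [], v => rw [word_nil, one_mul, extendL_word, chainSum_nil_right, one_mul]
    | u, [] => rw [word_nil, mul_one, extendL_word, chainSum_nil_right, mul_one]
    | a :: u, b :: v =>
      rw [← cons_word, ← cons_word, cons_mul_cons]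
      simp [extendL_chainSum_nil_cons, chainSum]
  | cons x xs ih =>
    match u, v with
    | [], v => rw [word_nil, one_mul, extendL_word, chainSum_nil_right, one_mul]
    | u, [] => rw [word_nil, mul_one, extendL_word, chainSum_nil_right, mul_one]
    | a :: u, b :: v =>
      have e := ih (a :: u) (b :: v)
      rw [← cons_word, ← cons_word, cons_mul_cons, map_add, map_add] at e
      rw [← cons_word, ← cons_word, cons_mul_cons, map_add, map_add, extendL_chainSum_cons,
        extendL_chainSum_cons, extendL_chainSum_cons, cons_word, cons_word, ih, ih, ih,
        chainSum, chainSum]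
      rw [cons_word, cons_word] at e
      linear_combination e

/-- The coefficient of a word. -/
def QS.coeff (α : List ℕ) : QS k →ₗ[k] k := Finsupp.lapply (R := k) (M := k) α

/-- The linear operator on `QS(ℕ)` that removes the first component `a` and annihilates the words
that do not begin with `a`. -/
def QS.tail (a : ℕ) : QS k →ₗ[k] QS k :=
  Finsupp.lcomapDomain (R := k) (M := k) (List.cons a) List.cons_injective

lemma QS.coeff_word (α β : List ℕ) : QS.coeff α (QS.word β : QS k) = if β = α then 1 else 0 :=
  Finsupp.single_apply

lemma QS.coeff_tail (a : ℕ) (α : List ℕ) (c : QS k) :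
    QS.coeff α (QS.tail a c) = QS.coeff (a :: α) c := rfl

lemma QS.ext_coeff {c d : QS k} (h : ∀ α, QS.coeff α c = QS.coeff α d) : c = d :=
  Finsupp.ext h

lemma QS.tail_word (a : ℕ) (α : List ℕ) : QS.tail a (QS.word (a :: α) : QS k) = QS.word α :=
  QS.ext_coeff fun β => by simp [QS.coeff_tail, QS.coeff_word]

lemma QS.tail_word_of_ne {a b : ℕ} (h : b ≠ a) (α : List ℕ) :
    QS.tail a (QS.word (b :: α) : QS k) = 0 :=
  QS.ext_coeff fun β => by simp [QS.coeff_tail, QS.coeff_word, h]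

lemma QS.tail_word_nil (a : ℕ) : QS.tail a (QS.word [] : QS k) = 0 :=
  QS.ext_coeff fun β => by simp [QS.coeff_tail, QS.coeff_word]

/-- The coefficient of each word can be read off by adjoining one polynomial variable per component.
This requires quantifying over all algebras, so that `A` may be replaced by `A[X]` in the induction.
-/
theorem eq_zero_of_extendL_chainSum {k : Type u} [CommRing k] (c : QS k)
    (h : ∀ (A : Type u) [CommRing A] [Algebra k A] (xs : List A), extendL (chainSum xs) c = 0) :
    c = 0 := by
  suffices H : ∀ (α : List ℕ) (c : QS k), (∀ (A : Type u) [CommRing A] [Algebra k A]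
      (xs : List A), extendL (chainSum xs) c = 0) → QS.coeff α c = 0 from
    QS.ext_coeff fun α => (H α c h).trans (map_zero _).symm
  intro α
  induction α with
  | nil =>
    intro c h
    -- On the empty sequence every nonempty word evaluates to 0.
    rw [← h k []]
    have : QS.coeff (k := k) [] = extendL (k := k) (chainSum ([] : List k)) := by
      refine QS.hom_ext fun β => ?_
      rw [extendL_word, QS.coeff_word]
      cases β <;> simp [chainSum]
    exact LinearMap.congr_fun this c
  | cons a α ih =>
    intro c h
    refine ih (QS.tail a c) fun A _ _ xs => ?_
    -- Subtracting the sum without the new variable leaves only the terms that use it, so that the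
    -- component `a = 0` is detected too.
    have e : extendL (k := k) (chainSum xs) ∘ₗ QS.tail a =
        ((Polynomial.lcoeff A a).restrictScalars k) ∘ₗ
          (extendL (chainSum (Polynomial.X :: xs.map Polynomial.C)) -
            extendL (chainSum (xs.map Polynomial.C))) := by
      refine QS.hom_ext fun β => ?_
      simp only [LinearMap.comp_apply, LinearMap.sub_apply, extendL_word]
      cases β with
      | nil =>
        rw [QS.tail_word_nil, map_zero, chainSum_nil_right, chainSum_nil_right, sub_self, map_zero]
      | cons b β =>
        rw [chainSum, add_sub_cancel_left, ← map_chainSum]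
        by_cases hab : b = a
        · subst hab
          rw [QS.tail_word, extendL_word]
          simp [Polynomial.coeff_X_pow]
        · rw [QS.tail_word_of_ne hab, map_zero]
          simp [Polynomial.coeff_X_pow, Ne.symm hab]
    have := LinearMap.congr_fun e c
    simp only [LinearMap.comp_apply, LinearMap.sub_apply, h, sub_zero, map_zero] at this
    exact this

end ChainSum

/-! ### Exponents of monomials and their largest index -/

section Expo

lemma expo_nil_left (α : List ℕ) : expo [] α = 0 := by simp [expo]

lemma expo_nil_right (I : List ℕ+) : expo I [] = 0 := by simp [expo]

lemma expo_cons (i : ℕ+) (I : List ℕ+) (a : ℕ) (α : List ℕ) :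
    expo (i :: I) (a :: α) = Finsupp.single i a + expo I α := by simp [expo]

lemma expo_concat {I : List ℕ+} {α : List ℕ} (h : I.length = α.length) (i : ℕ+) (a : ℕ) :
    expo (I ++ [i]) (α ++ [a]) = expo I α + Finsupp.single i a := by
  simp [expo, List.zipWith_append h]

lemma mem_of_mem_support_expo {I : List ℕ+} {α : List ℕ} {i : ℕ+}
    (h : i ∈ (expo I α).support) : i ∈ I := by
  induction I generalizing α with
  | nil => simp [expo_nil_left] at h
  | cons x I ih =>
    cases α with
    | nil => simp [expo_nil_right] at h
    | cons a α =>
      rw [expo_cons] at h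
      rcases Finset.mem_union.1 (Finsupp.support_add h) with h | h
      · have := Finsupp.support_single_subset h
        simp_all
      · exact List.mem_cons_of_mem _ (ih h)

/-- The largest index of a variable occurring in a monomial, or `0` if there is none. -/
def top (μ : ℕ+ →₀ ℕ) : ℕ := μ.support.sup fun i => (i : ℕ)

lemma top_le_iff {μ : ℕ+ →₀ ℕ} {N : ℕ} : top μ ≤ N ↔ ∀ i ∈ μ.support, (i : ℕ) ≤ N :=
  Finset.sup_le_iff

lemma le_top {μ : ℕ+ →₀ ℕ} {i : ℕ+} (h : i ∈ μ.support) : (i : ℕ) ≤ top μ :=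
  Finset.le_sup (f := fun i : ℕ+ => (i : ℕ)) h

lemma top_zero : top 0 = 0 := by simp [top]

lemma top_le_of_le {μ ν : ℕ+ →₀ ℕ} (h : μ ≤ ν) : top μ ≤ top ν :=
  Finset.sup_mono (Finsupp.support_mono h)

lemma IsLeftWeak.concat_pos {v : List ℕ} {a : ℕ} (h : IsLeftWeak (v ++ [a])) : 0 < a := by
  simpa using h (by simp)

/-- For a left weak composition, the last index of a term is the largest index occurring in the
monomial. -/
lemma getLast_eq_top {v : List ℕ} {a : ℕ} (hv : IsLeftWeak (v ++ [a])) {I : List ℕ+} {i : ℕ+}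
    {μ : ℕ+ →₀ ℕ} (hs : (I ++ [i]).Pairwise (· < ·)) (hl : I.length = v.length)
    (he : expo (I ++ [i]) (v ++ [a]) = μ) : (i : ℕ) = top μ := by
  apply le_antisymm
  · apply le_top
    rw [← he, expo_concat hl]
    have := hv.concat_pos
    simp
    omega
  · rw [top_le_iff]
    intro x hx
    rw [← he] at hx
    have := mem_of_mem_support_expo hx
    rcases List.mem_append.1 this with h | h
    · exact_mod_cast ((List.pairwise_append.1 hs).2.2 x h i (by simp)).le
    · simp_all

lemma le_top_of_mem_idx {v : List ℕ} (hv : IsLeftWeak v) {μ : ℕ+ →₀ ℕ} {I : List ℕ+}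
    (hs : I.Pairwise (· < ·)) (hl : I.length = v.length) (he : expo I v = μ) {x : ℕ+}
    (hx : x ∈ I) : (x : ℕ) ≤ top μ := by
  rcases List.eq_nil_or_concat I with rfl | ⟨I, i, rfl⟩
  · simp at hx
  rcases List.eq_nil_or_concat v with rfl | ⟨v, a, rfl⟩
  · simp at hl
  simp only [List.concat_eq_append] at *
  have e := getLast_eq_top hv hs (by simpa using hl) he
  rw [← e]
  rcases List.mem_append.1 hx with h | h
  · exact_mod_cast ((List.pairwise_append.1 hs).2.2 x h i (by simp)).le
  · simp_all

/-- The list `1, …, N`. -/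
def idxList (N : ℕ) : List ℕ+ := (List.range N).map Nat.succPNat

lemma idxList_succ (N : ℕ) : idxList (N + 1) = idxList N ++ [N.succPNat] := by
  simp [idxList, List.range_succ]

lemma mem_idxList {N : ℕ} {i : ℕ+} : i ∈ idxList N ↔ (i : ℕ) ≤ N := by
  simp only [idxList, List.mem_map, List.mem_range]
  constructor
  · rintro ⟨a, ha, rfl⟩
    simpa using ha
  · intro h
    exact ⟨i.natPred, by have := i.natPred_add_one; omega, by simp⟩

lemma pairwise_idxList (N : ℕ) : (idxList N).Pairwise (· < ·) := by
  refine List.Pairwise.map _ (fun a b h => ?_) List.pairwise_lt_range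
  exact Nat.succPNat_lt_succPNat.2 h

lemma sublist_idxList {N : ℕ} {I : List ℕ+} :
    List.Sublist I (idxList N) ↔ I.Pairwise (· < ·) ∧ ∀ i ∈ I, (i : ℕ) ≤ N := by
  constructor
  · exact fun h => ⟨(pairwise_idxList N).sublist h, fun i hi => mem_idxList.1 (h.subset hi)⟩
  · rintro ⟨h1, h2⟩
    refine List.sublist_of_subperm_of_pairwise ?_ h1 (pairwise_idxList N)
    exact List.subperm_of_subset (h1.imp fun h => h.ne) fun i hi => mem_idxList.2 (h2 i hi)

end Expo

/-! ### Coefficients of the truncations to finitely many variables -/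

section Count

variable {k : Type*} [CommRing k]

lemma chainSum_concat {A : Type*} [CommRing A] (xs : List A) (x : A) (α : List ℕ) (a : ℕ) :
    chainSum (xs ++ [x]) (α ++ [a]) = chainSum xs (α ++ [a]) + x ^ a * chainSum xs α := by
  induction xs generalizing α with
  | nil =>
    match α with
    | [] => simp [chainSum]
    | b :: [] => simp [chainSum]
    | b :: c :: α => simp [chainSum]
  | cons y xs ih =>
    cases α with
    | nil =>
      have := ih []
      simp only [List.nil_append, List.cons_append, chainSum, chainSum_nil_right] at this ⊢
      rw [this]; ring
    | cons b α =>
      have h1 := ih (b :: α)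
      have h2 := ih α
      simp only [List.cons_append, chainSum] at h1 h2 ⊢
      rw [h1, h2]; ring

/-- The sum `∑_{i₁ < ⋯ < iᵣ ≤ N} x_{i₁} ^ α₁ ⋯ x_{iᵣ} ^ αᵣ`. -/
def truncQSym (k : Type*) [CommRing k] (N : ℕ) (α : List ℕ) : MvPolynomial ℕ+ k :=
  chainSum ((idxList N).map MvPolynomial.X) α

lemma chainSum_map_X (l : List ℕ+) (α : List ℕ) :
    chainSum (l.map (MvPolynomial.X (R := k))) α =
      ((l.sublistsLen α.length).map fun I => MvPolynomial.monomial (expo I α) (1 : k)).sum := by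
  induction l generalizing α with
  | nil => cases α <;> simp [chainSum, expo_nil_left]
  | cons i l ih =>
    cases α with
    | nil => simp [chainSum, expo_nil_left]
    | cons a α =>
      rw [List.map_cons, chainSum, ih, ih, List.length_cons, List.sublistsLen_succ_cons,
        List.map_append, List.sum_append, List.map_map, ← List.sum_map_mul_left]
      simp [Function.comp_def, expo_cons, MvPolynomial.X_pow_eq_monomial,
        MvPolynomial.monomial_mul]

open Classical in
lemma coeff_chainSum_map_X (l : List ℕ+) (α : List ℕ) (μ : ℕ+ →₀ ℕ) :
    MvPolynomial.coeff μ (chainSum (l.map (MvPolynomial.X (R := k))) α) =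
      (((l.sublistsLen α.length).filter fun I => expo I α = μ).length : k) := by
  rw [chainSum_map_X]
  induction l.sublistsLen α.length with
  | nil => simp
  | cons I L ih =>
    rw [List.map_cons, List.sum_cons, MvPolynomial.coeff_add, ih, MvPolynomial.coeff_monomial,
      List.filter_cons]
    by_cases h : expo I α = μ <;> simp [h, add_comm]

lemma coeff_truncQSym_of_lt {N : ℕ} {μ : ℕ+ →₀ ℕ} (h : N < top μ) (α : List ℕ) :
    MvPolynomial.coeff μ (truncQSym k N α) = 0 := by
  classical
  rw [truncQSym, coeff_chainSum_map_X]
  rw [List.filter_eq_nil_iff.2, List.length_nil, Nat.cast_zero]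
  intro I hI he
  refine absurd (top_le_iff.2 fun i hi => ?_) (not_le.2 h)
  rw [← of_decide_eq_true he] at hi
  exact (sublist_idxList.1 (List.mem_sublistsLen.1 hI).1).2 i (mem_of_mem_support_expo hi)

open Classical in
/-- The terms of a monomial quasisymmetric function equal to a given monomial. -/
def idxEquiv {v : List ℕ} (hv : IsLeftWeak v) {μ : ℕ+ →₀ ℕ} {N : ℕ} (h : top μ ≤ N) :
    Idx v μ ≃ {I // I ∈ (((idxList N).sublistsLen v.length).filter fun I => expo I v = μ)} :=
  Equiv.subtypeEquivRight fun I => by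
    rw [List.mem_filter, List.mem_sublistsLen, sublist_idxList, decide_eq_true_iff]
    constructor
    · rintro ⟨h1, h2, h3⟩
      exact ⟨⟨⟨h1, fun i hi => (le_top_of_mem_idx hv h1 h2 h3 hi).trans h⟩, h2⟩, h3⟩
    · rintro ⟨⟨⟨h1, -⟩, h2⟩, h3⟩
      exact ⟨h1, h2, h3⟩

lemma finite_idx {v : List ℕ} (hv : IsLeftWeak v) (μ : ℕ+ →₀ ℕ) : Finite (Idx v μ) :=
  Finite.of_equiv _ (idxEquiv hv le_rfl).symm

lemma coeff_truncQSym_of_isLeftWeak {v : List ℕ} (hv : IsLeftWeak v) {μ : ℕ+ →₀ ℕ} {N : ℕ}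
    (h : top μ ≤ N) : MvPolynomial.coeff μ (truncQSym k N v) = (Nat.card (Idx v μ) : k) := by
  classical
  rw [truncQSym, coeff_chainSum_map_X, Nat.card_congr (idxEquiv hv h)]
  congr 1
  have hn : (((idxList N).sublistsLen v.length).filter fun I => expo I v = μ).Nodup :=
    (List.nodup_sublistsLen _ ((pairwise_idxList N).imp fun h => h.ne)).filter _
  rw [Nat.card_eq_fintype_card, ← List.toFinset_card_of_nodup hn, ← Fintype.card_coe]
  exact Fintype.card_congr (Equiv.subtypeEquivRight fun I => by rw [List.mem_toFinset])

/-- The indices belonging to `v` end exactly at `top μ`, and those of the zeros form an arbitrary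
`m`-subset of the indices from `top μ + 1` to `N`. The induction on `N` is Pascal's rule. -/
lemma coeff_truncQSym_append {v : List ℕ} (hv : IsLeftWeak v) {μ : ℕ+ →₀ ℕ} (m : ℕ) {N : ℕ}
    (h : top μ ≤ N) : MvPolynomial.coeff μ (truncQSym k N (v ++ List.replicate m 0)) =
      (Nat.card (Idx v μ) * (N - top μ).choose m : ℕ) := by
  induction m generalizing N with
  | zero => simpa using coeff_truncQSym_of_isLeftWeak hv h
  | succ m ih =>
    have hrec : ∀ N, truncQSym k (N + 1) (v ++ List.replicate (m + 1) 0) =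
        truncQSym k N (v ++ List.replicate (m + 1) 0) +
          truncQSym k N (v ++ List.replicate m 0) := by
      intro N
      rw [List.replicate_succ', ← List.append_assoc, truncQSym, idxList_succ, List.map_append,
        List.map_singleton, chainSum_concat, pow_zero, one_mul]
      rfl
    induction N, h using Nat.le_induction with
    | base =>
      rw [Nat.sub_self, Nat.choose_zero_succ, mul_zero, Nat.cast_zero]
      -- No index remains for a trailing zero: removing the last variable leaves truncations that do
      -- not contain `x_{top μ}`. If `top μ = 0` there is no variable at all.
      rcases hj : top μ with _ | j
      · have : ∀ α : List ℕ, α ≠ [] → truncQSym k 0 α = 0 := by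
          intro α hα
          cases α with
          | nil => exact absurd rfl hα
          | cons a α => rfl
        rw [this _ (by simp), MvPolynomial.coeff_zero]
      · rw [hrec, MvPolynomial.coeff_add, coeff_truncQSym_of_lt (by omega),
          coeff_truncQSym_of_lt (by omega), add_zero]
    | succ N h ihN =>
      rw [hrec, MvPolynomial.coeff_add, ihN, ih h, Nat.sub_add_comm h, Nat.choose_succ_succ]
      push_cast
      ring

lemma exists_eq_append_replicate (α : List ℕ) :
    ∃ (v : List ℕ) (m : ℕ), IsLeftWeak v ∧ α = v ++ List.replicate m 0 := by
  induction α using List.reverseRecOn with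
  | nil => exact ⟨[], 0, fun h => absurd rfl h, rfl⟩
  | append_singleton α a ih =>
    rcases Nat.eq_zero_or_pos a with rfl | ha
    · obtain ⟨v, m, hv, rfl⟩ := ih
      exact ⟨v, m + 1, hv, by rw [List.replicate_succ', List.append_assoc]⟩
    · exact ⟨α ++ [a], 0, fun _ => by simpa using ha, by simp⟩

/-- The truncation to `N` variables is the universal case of a sequence of length `N`: any such
sequence in `A` is a specialization of `x_1, …, x_N`. -/
theorem eq_zero_of_extendL_truncQSym {k : Type u} [CommRing k] (c : QS k)
    (h : ∀ N, extendL (truncQSym k N) c = 0) : c = 0 := by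
  refine eq_zero_of_extendL_chainSum c fun A _ _ xs => ?_
  let φ : MvPolynomial ℕ+ k →ₐ[k] A := MvPolynomial.aeval fun i => xs.getD i.natPred 0
  have hx : ((idxList xs.length).map MvPolynomial.X).map φ = xs := by
    apply List.ext_getElem
    · simp [idxList]
    · intro i h1 h2
      simp [idxList, φ, h2]
  have : extendL (k := k) (chainSum xs) = φ.toLinearMap ∘ₗ extendL (truncQSym k xs.length) := by
    refine QS.hom_ext fun α => ?_
    rw [LinearMap.comp_apply, extendL_word, extendL_word, AlgHom.toLinearMap_apply, truncQSym]
    have := map_chainSum (φ : MvPolynomial ℕ+ k →+* A)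
      ((idxList xs.length).map (MvPolynomial.X (R := k))) α
    rw [AlgHom.coe_toRingHom] at this
    rw [this, hx]
  rw [this, LinearMap.comp_apply, h, map_zero]

end Count

/-! ### Binomial polynomials and polynomials with many zeros -/

section ChooseQ

variable {A : Type*} [CommRing A] [Algebra ℚ A]

/-- The binomial coefficient `y (y - 1) ⋯ (y - m + 1) / m!` in a `ℚ`-algebra. -/
def chooseQ (y : A) : ℕ → A
  | 0 => 1
  | m + 1 => ((m + 1 : ℚ)⁻¹) • (chooseQ y m * (y - m))

lemma map_chooseQ {B : Type*} [CommRing B] [Algebra ℚ B] (f : A →+* B) (y : A) (m : ℕ) :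
    f (chooseQ y m) = chooseQ (f y) m := by
  induction m with
  | zero => simp [chooseQ]
  | succ m ih =>
    simp only [chooseQ, Algebra.smul_def, map_mul, map_sub, ih, map_natCast]
    congr 1
    exact RingHom.congr_fun (Subsingleton.elim (f.comp (algebraMap ℚ A)) (algebraMap ℚ B)) _

lemma succ_mul_chooseQ_succ (y : A) (m : ℕ) :
    (m + 1 : A) * chooseQ y (m + 1) = chooseQ y m * (y - m) := by
  have h : (m + 1 : A) = algebraMap ℚ A (m + 1) := by simp
  rw [chooseQ, h, Algebra.smul_def, ← mul_assoc, ← map_mul,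
    mul_inv_cancel₀ (by positivity), map_one, one_mul]

lemma isUnit_natCast_of_ratAlgebra {n : ℕ} (h : n ≠ 0) : IsUnit (n : A) := by
  rw [← map_natCast (algebraMap ℚ A)]
  exact (IsUnit.mk0 (n : ℚ) (Nat.cast_ne_zero.2 h)).map _

lemma chooseQ_natCast (n m : ℕ) : chooseQ (n : A) m = (n.choose m : A) := by
  induction m with
  | zero => simp [chooseQ]
  | succ m ih =>
    refine (isUnit_natCast_of_ratAlgebra (A := A) m.succ_ne_zero).mul_left_cancel ?_
    rw [Nat.succ_eq_add_one, Nat.cast_add_one, succ_mul_chooseQ_succ, ih]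
    rcases le_or_gt m n with h | h
    · rw [← Nat.cast_sub h, ← Nat.cast_add_one, ← Nat.cast_mul, ← Nat.cast_mul,
        ← Nat.choose_succ_right_eq, mul_comm]
    · rw [Nat.choose_eq_zero_of_lt h, Nat.choose_eq_zero_of_lt (by omega)]
      simp

/-- A polynomial over a `ℚ`-algebra vanishing at infinitely many points with invertible
differences is zero. -/
lemma eq_zero_of_eval_eq_zero {k : Type*} [CommRing k] (s : ℕ → k)
    (hs : ∀ i j, i < j → IsUnit (s j - s i)) (r : k[X]) (N : ℕ)
    (h : ∀ n, N ≤ n → r.eval (s n) = 0) : r = 0 := by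
  nontriviality k
  induction hd : r.natDegree using Nat.strong_induction_on generalizing r N with
  | _ d ih =>
  by_contra hr
  -- Split off the factor `X - s N`. Its values at the later points are units, so the quotient, of
  -- smaller degree, vanishes there; `k` need not be a domain.
  have hroot := Polynomial.mul_divByMonic_eq_iff_isRoot.2 (h N le_rfl)
  set q := r /ₘ (Polynomial.X - Polynomial.C (s N)) with hq
  have hq0 : q ≠ 0 := by
    intro h0
    rw [h0, mul_zero] at hroot
    exact hr hroot.symm
  have hdeg : d = 1 + q.natDegree := by
    rw [← hd, ← hroot, (Polynomial.monic_X_sub_C _).natDegree_mul' hq0,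
      Polynomial.natDegree_X_sub_C]
  refine hq0 (ih q.natDegree (by omega) q (N + 1) (fun n hn => ?_) rfl)
  have := h n (by omega)
  rw [← hroot, Polynomial.eval_mul, Polynomial.eval_sub, Polynomial.eval_X,
    Polynomial.eval_C] at this
  exact (hs N n (by omega)).mul_right_eq_zero.1 this

end ChooseQ

/-! ### Coefficients of monomials as polynomials in `t` -/

section MonomialCoeff

variable {k : Type*} [CommRing k]

lemma coeff_sum_monomial_coeff (μ : ℕ+ →₀ ℕ) (p : (MvPowerSeries ℕ+ k)[X]) (n : ℕ) :
    (∑ i ∈ Finset.range (p.natDegree + 1),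
      Polynomial.monomial i (MvPowerSeries.coeff μ (p.coeff i))).coeff n =
        MvPowerSeries.coeff μ (p.coeff n) := by
  simp only [Polynomial.finsetSum_coeff, Polynomial.coeff_monomial,
      Finset.sum_ite_eq', Finset.mem_range, Nat.lt_succ_iff]
  split_ifs with h
  · rfl
  · rw [Polynomial.coeff_eq_zero_of_natDegree_lt (not_le.1 h), map_zero]

/-- The coefficient in `k[t]` of a monomial in the variables `X` of an element of `k[[X]][t]`. -/
def monomialCoeff (μ : ℕ+ →₀ ℕ) : (MvPowerSeries ℕ+ k)[X] →ₗ[k] k[X] where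
  toFun p := ∑ i ∈ Finset.range (p.natDegree + 1),
    Polynomial.monomial i (MvPowerSeries.coeff μ (p.coeff i))
  map_add' p q := by
    ext n
    rw [Polynomial.coeff_add]
    iterate 3 rw [coeff_sum_monomial_coeff]
    rw [Polynomial.coeff_add, map_add]
  map_smul' c p := by
    ext n
    rw [Polynomial.coeff_smul]
    iterate 2 rw [coeff_sum_monomial_coeff]
    rw [Polynomial.coeff_smul, map_smul, RingHom.id_apply]

lemma coeff_monomialCoeff (μ : ℕ+ →₀ ℕ) (p : (MvPowerSeries ℕ+ k)[X]) (n : ℕ) :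
    (monomialCoeff μ p).coeff n = MvPowerSeries.coeff μ (p.coeff n) :=
  coeff_sum_monomial_coeff μ p n

lemma ext_monomialCoeff {p q : (MvPowerSeries ℕ+ k)[X]}
    (h : ∀ μ, monomialCoeff μ p = monomialCoeff μ q) : p = q := by
  ext n μ
  rw [← coeff_monomialCoeff, ← coeff_monomialCoeff, h]

lemma monomialCoeff_map_C_mul (μ : ℕ+ →₀ ℕ) (a : k[X]) (p : (MvPowerSeries ℕ+ k)[X]) :
    monomialCoeff μ (a.map MvPowerSeries.C * p) = a * monomialCoeff μ p := by
  ext n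
  simp [coeff_monomialCoeff, Polynomial.coeff_mul]

lemma coeff_eval_C (μ : ℕ+ →₀ ℕ) (τ : k) (p : (MvPowerSeries ℕ+ k)[X]) :
    MvPowerSeries.coeff μ (p.eval (MvPowerSeries.C τ)) = (monomialCoeff μ p).eval τ := by
  have h : (monomialCoeff μ p).natDegree < p.natDegree + 1 := by
    rw [Nat.lt_succ_iff, Polynomial.natDegree_le_iff_coeff_eq_zero]
    intro n hn
    rw [coeff_monomialCoeff, Polynomial.coeff_eq_zero_of_natDegree_lt hn, map_zero]
  rw [Polynomial.eval_eq_sum_range, Polynomial.eval_eq_sum_range' h, map_sum]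
  refine Finset.sum_congr rfl fun i _ => ?_
  rw [coeff_monomialCoeff, ← map_pow, MvPowerSeries.coeff_mul_C]

lemma monomialCoeff_C (μ : ℕ+ →₀ ℕ) (f : MvPowerSeries ℕ+ k) :
    monomialCoeff μ (Polynomial.C f) = Polynomial.C (MvPowerSeries.coeff μ f) := by
  ext n
  rw [coeff_monomialCoeff, Polynomial.coeff_C, Polynomial.coeff_C]
  split_ifs <;> simp

end MonomialCoeff

/-! ### Consequences of the coefficient formula: multiplicativity and injectivity -/

section Renormalized

variable {k : Type*} [CommRing k] [Algebra ℚ k]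

variable (k) in
/-- The polynomial `-t - 1 / 2`. -/
def shiftedT : k[X] := -Polynomial.X - Polynomial.C (algebraMap ℚ k (1 / 2))

/-- The formula for the coefficients of the renormalized monomial quasisymmetric functions. -/
def IsRenormalized (M : List ℕ → (MvPowerSeries ℕ+ k)[X]) : Prop :=
  ∀ (v : List ℕ) (m : ℕ) (μ : ℕ+ →₀ ℕ), IsLeftWeak v →
    monomialCoeff μ (M (v ++ List.replicate m 0)) =
      (Nat.card (Idx v μ) : k[X]) * chooseQ (shiftedT k - (top μ : k[X])) m

variable (k) in
/-- The point at which `-t - 1 / 2` takes the value `N`. -/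
def evalPoint (N : ℕ) : k := algebraMap ℚ k (-N - 1 / 2)

lemma eval_shiftedT (N : ℕ) : (shiftedT k).eval (evalPoint k N) = N := by
  simp only [shiftedT, Polynomial.eval_sub, Polynomial.eval_neg, Polynomial.eval_X,
    Polynomial.eval_C, evalPoint]
  rw [← map_neg, ← map_sub]
  simp

lemma isUnit_evalPoint_sub {i j : ℕ} (h : i < j) : IsUnit (evalPoint k j - evalPoint k i) := by
  rw [evalPoint, evalPoint, ← map_sub]
  refine (IsUnit.mk0 _ ?_).map _
  have : (i : ℚ) < j := by exact_mod_cast h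
  intro h0
  linarith

variable {M : List ℕ → (MvPowerSeries ℕ+ k)[X]}

/-- At this point `-t - 1/2 - top μ` becomes the natural number `N - top μ`, and the binomial
polynomial counts the positions of the trailing zeros. -/
lemma IsRenormalized.coeff_eval (hM : IsRenormalized M) {N : ℕ} {μ : ℕ+ →₀ ℕ} (h : top μ ≤ N)
    (α : List ℕ) : MvPowerSeries.coeff μ ((M α).eval (MvPowerSeries.C (evalPoint k N))) =
      MvPolynomial.coeff μ (truncQSym k N α) := by
  obtain ⟨v, m, hv, rfl⟩ := exists_eq_append_replicate α
  rw [coeff_eval_C, hM v m μ hv, coeff_truncQSym_append hv m h, Polynomial.eval_mul,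
    Polynomial.eval_natCast, ← Polynomial.coe_evalRingHom, map_chooseQ,
    Polynomial.coe_evalRingHom, Polynomial.eval_sub, eval_shiftedT, Polynomial.eval_natCast,
    ← Nat.cast_sub h, chooseQ_natCast, Nat.cast_mul]

lemma IsRenormalized.coeff_eval_extendL (hM : IsRenormalized M) {N : ℕ} {μ : ℕ+ →₀ ℕ}
    (h : top μ ≤ N) (c : QS k) :
    MvPowerSeries.coeff μ ((extendL M c).eval (MvPowerSeries.C (evalPoint k N))) =
      MvPolynomial.coeff μ (extendL (truncQSym k N) c) := by
  have : MvPowerSeries.coeff μ ∘ₗ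
      ((Polynomial.leval (MvPowerSeries.C (evalPoint k N))).restrictScalars k) ∘ₗ extendL M =
      (MvPolynomial.lcoeff k μ) ∘ₗ extendL (truncQSym k N) := by
    refine QS.hom_ext fun α => ?_
    simpa [extendL_word] using hM.coeff_eval h α
  exact LinearMap.congr_fun this c

/-- For a fixed monomial the difference is a polynomial in `t` with zeros at all `evalPoint k N`, `N
≥ top μ`, and these points have invertible differences. -/
lemma eq_of_coeff_eval {p q : (MvPowerSeries ℕ+ k)[X]}
    (h : ∀ (μ : ℕ+ →₀ ℕ) (N : ℕ), top μ ≤ N →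
      MvPowerSeries.coeff μ (p.eval (MvPowerSeries.C (evalPoint k N))) =
      MvPowerSeries.coeff μ (q.eval (MvPowerSeries.C (evalPoint k N)))) : p = q := by
  refine ext_monomialCoeff fun μ => ?_
  rw [← sub_eq_zero]
  refine eq_zero_of_eval_eq_zero (evalPoint k) (fun i j => isUnit_evalPoint_sub) _ (top μ) ?_
  intro n hn
  rw [Polynomial.eval_sub, ← coeff_eval_C, ← coeff_eval_C, h μ n hn, sub_self]

lemma IsRenormalized.nil (hM : IsRenormalized M) : M [] = 1 := by
  refine eq_of_coeff_eval fun μ N h => ?_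
  rw [hM.coeff_eval h, truncQSym, chainSum_nil_right, Polynomial.eval_one, MvPolynomial.coeff_one,
    MvPowerSeries.coeff_one]
  simp [eq_comm]

/-- A divisor of `μ` involves no index beyond `top μ ≤ N`, so every coefficient entering the product
is one of a truncation, where multiplicativity is known. -/
lemma IsRenormalized.mul (hM : IsRenormalized M) (u v : List ℕ) :
    extendL M (QS.word u * QS.word v : QS k) = M u * M v := by
  refine eq_of_coeff_eval fun μ N h => ?_
  rw [hM.coeff_eval_extendL h, Polynomial.eval_mul, MvPowerSeries.coeff_mul]
  have e := extendL_chainSum_mul (k := k) ((idxList N).map (MvPolynomial.X (R := k))) u v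
  change extendL (truncQSym k N) _ = truncQSym k N u * truncQSym k N v at e
  rw [e, MvPolynomial.coeff_mul]
  refine Finset.sum_congr rfl fun x hx => ?_
  have hx := Finset.HasAntidiagonal.mem_antidiagonal.1 hx
  rw [hM.coeff_eval ((top_le_of_le (by rw [← hx]; exact le_self_add)).trans h),
    hM.coeff_eval ((top_le_of_le (by rw [← hx]; exact le_add_self)).trans h)]

/-- The algebra homomorphism `α ↦ M_α`. -/
def IsRenormalized.hom (hM : IsRenormalized M) : QS k →ₐ[k] (MvPowerSeries ℕ+ k)[X] :=
  liftHom M hM.nil hM.mul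

lemma IsRenormalized.hom_word (hM : IsRenormalized M) (α : List ℕ) : hM.hom (QS.word α) = M α :=
  liftHom_word M hM.nil hM.mul α

/-- A relation between the `M_α` specializes to one between the truncations for every `N`; monomials
with `top μ > N` do not occur in those. -/
lemma IsRenormalized.hom_injective (hM : IsRenormalized M) : Function.Injective hM.hom := by
  rw [injective_iff_map_eq_zero]
  intro c hc
  refine eq_zero_of_extendL_truncQSym c fun N => ?_
  ext μ
  rw [MvPolynomial.coeff_zero]
  rcases le_or_gt (top μ) N with h | h
  · rw [← hM.coeff_eval_extendL h, show extendL M c = 0 from hc, Polynomial.eval_zero, map_zero]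
  · have : (MvPolynomial.lcoeff k μ) ∘ₗ extendL (truncQSym k N) = 0 := by
      refine QS.hom_ext fun α => ?_
      simpa [extendL_word] using coeff_truncQSym_of_lt h α
    exact LinearMap.congr_fun this c

lemma IsRenormalized.of_isLeftWeak (hM : IsRenormalized M) {v : List ℕ} (hv : IsLeftWeak v) :
    M v = Polynomial.C (monoQSym k v) := by
  refine ext_monomialCoeff fun μ => ?_
  have := hM v 0 μ hv
  rw [List.replicate_zero, List.append_nil, chooseQ, mul_one] at this
  rw [this, monomialCoeff_C, ← map_natCast Polynomial.C]
  rfl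

lemma isLeftWeak_nil : IsLeftWeak [] := fun h => absurd rfl h

/-- The left weak part is empty, so only the monomial 1 occurs, with `top 0 = 0`. This value is what
brings `t` into the image. -/
lemma IsRenormalized.zero (hM : IsRenormalized M) :
    M [0] = (shiftedT k).map MvPowerSeries.C := by
  have h1 := hM.of_isLeftWeak isLeftWeak_nil
  refine ext_monomialCoeff fun μ => ?_
  have h2 := hM [] 0 μ isLeftWeak_nil
  have := hM [] 1 μ isLeftWeak_nil
  simp only [List.nil_append, List.replicate_one, List.replicate_zero, chooseQ, mul_one] at this h2
  rw [this, ← h2, hM.nil]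
  have h3 : monomialCoeff μ (1 : (MvPowerSeries ℕ+ k)[X]) = if μ = 0 then 1 else 0 := by
    rw [← Polynomial.C_1, monomialCoeff_C, MvPowerSeries.coeff_one]
    split_ifs <;> simp
  rw [← mul_one ((shiftedT k).map _), monomialCoeff_map_C_mul, h3]
  split_ifs with h
  · simp [h, top_zero]
  · simp

end Renormalized

/-! ### Quasi-shuffle multiplication by the word `(0)` -/

section QuasiShuffleByZero

variable {k : Type*} [CommRing k]

lemma word_cons_mul_word_zero (a : ℕ) (u : List ℕ) :
    (QS.word (a :: u) * QS.word [0] : QS k) =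
      QS.cons a (QS.word u * QS.word [0]) + QS.word (0 :: a :: u) + QS.word (a :: u) := by
  rw [← cons_word a u, ← cons_word 0 [], cons_mul_cons, word_nil, mul_one, mul_one, add_zero,
    cons_word, cons_word]

/-- The new zero is inserted at one of `m + 1` places or merged with one of the `m` zeros. -/
lemma word_replicate_mul_word_zero (m : ℕ) :
    (QS.word (List.replicate m 0) * QS.word [0] : QS k) =
      (m + 1 : k) • QS.word (List.replicate (m + 1) 0) +
        (m : k) • QS.word (List.replicate m 0) := by
  induction m with
  | zero => simp [word_nil]
  | succ m ih =>
    rw [List.replicate_succ, word_cons_mul_word_zero, ih, map_add, map_smul, map_smul, cons_word,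
      cons_word]
    simp only [← List.replicate_succ]
    push_cast
    module

variable (k) in
/-- The span of the words with a positive component and at most `m` trailing zeros. -/
def trailingSpan (m : ℕ) : Submodule k (QS k) :=
  Submodule.span k {x | ∃ (v : List ℕ) (j : ℕ), v ≠ [] ∧ IsLeftWeak v ∧ j ≤ m ∧
    x = QS.word (v ++ List.replicate j 0)}

lemma IsLeftWeak.cons {v : List ℕ} (hv : IsLeftWeak v) (h : v ≠ []) (a : ℕ) :
    IsLeftWeak (a :: v) := fun _ => by
  rw [List.getLast_cons h]
  exact hv h

lemma isLeftWeak_of_cons {v : List ℕ} {a : ℕ} (hv : IsLeftWeak (a :: v)) : IsLeftWeak v :=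
  fun h => by
    have := hv (by simp)
    rwa [List.getLast_cons h] at this

lemma cons_mem_trailingSpan {m : ℕ} (a : ℕ) {x : QS k} (hx : x ∈ trailingSpan k m) :
    QS.cons a x ∈ trailingSpan k m := by
  have : trailingSpan k m ≤ (trailingSpan k m).comap (QS.cons a) := by
    refine Submodule.span_le.2 ?_
    rintro _ ⟨v, j, h0, hv, hj, rfl⟩
    refine Submodule.subset_span ⟨a :: v, j, by simp, hv.cons h0 a, hj, ?_⟩
    rw [cons_word, List.cons_append]
  exact this hx

lemma word_mem_trailingSpan {v : List ℕ} (h0 : v ≠ []) (hv : IsLeftWeak v) (m : ℕ) :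
    QS.word (v ++ List.replicate m 0) ∈ trailingSpan k m :=
  Submodule.subset_span ⟨v, m, h0, hv, le_rfl, rfl⟩

/-- Inserting the zero behind the last positive component gives the longer word `m + 1` times. Every
other insertion, and every merger, keeps a positive component and at most `m` trailing zeros. -/
lemma word_append_mul_word_zero {v : List ℕ} (h0 : v ≠ []) (hv : IsLeftWeak v) (m : ℕ) :
    (QS.word (v ++ List.replicate m 0) * QS.word [0] : QS k) -
      (m + 1 : k) • QS.word (v ++ List.replicate (m + 1) 0) ∈ trailingSpan k m := by
  induction v with
  | nil => exact absurd rfl h0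
  | cons a v ih =>
    have h1 := word_mem_trailingSpan (k := k) h0 hv m
    have h2 := word_mem_trailingSpan (k := k) (List.cons_ne_nil 0 (a :: v)) (hv.cons h0 0) m
    rw [List.cons_append] at h1
    rw [List.cons_append, List.cons_append] at h2
    rw [List.cons_append, word_cons_mul_word_zero]
    -- Here the block of zeros follows `a` directly: the `m` mergers inside the block and the merger
    -- with `a` give the coefficient `m + 1` of the old word.
    rcases eq_or_ne v [] with rfl | h
    · have e : (QS.cons a (QS.word ([] ++ List.replicate m 0) * QS.word [0]) : QS k) +
          QS.word (0 :: a :: ([] ++ List.replicate m 0)) +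
          QS.word (a :: ([] ++ List.replicate m 0)) -
          (m + 1 : k) • QS.word (a :: [] ++ List.replicate (m + 1) 0) =
          QS.word (0 :: a :: ([] ++ List.replicate m 0)) +
          (m + 1 : k) • QS.word (a :: ([] ++ List.replicate m 0)) := by
        simp only [List.nil_append, List.cons_append]
        rw [word_replicate_mul_word_zero, map_add, map_smul, map_smul, cons_word, cons_word]
        module
      rw [e]
      exact add_mem h2 (Submodule.smul_mem _ _ h1)
    · have := cons_mem_trailingSpan a (ih h (isLeftWeak_of_cons hv))
      rw [map_sub, map_smul, cons_word] at this
      convert add_mem (add_mem this h2) h1 using 1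
      rw [List.cons_append]
      abel

end QuasiShuffleByZero

/-! ### Adjoining the variable `x` -/

section Extension

variable {k : Type*} [CommRing k] {R : Type*} [CommRing R] [Algebra k R]

/-- The homomorphism `x ^ n ⊗ u ↦ x ^ n h(u)`. -/
def shaExtend (h : QS k →ₐ[k] R) : Sha k →ₐ[k] R[X] :=
  Algebra.TensorProduct.productMap (Polynomial.aeval Polynomial.X) (Polynomial.CAlgHom.comp h)

lemma shaExtend_X_pow_tmul (h : QS k →ₐ[k] R) (n : ℕ) (u : QS k) :
    shaExtend h ((Polynomial.X ^ n) ⊗ₜ u) = Polynomial.X ^ n * Polynomial.C (h u) := by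
  simp [shaExtend]

/-- Since `k[x]` is free on the powers of `x`, the tensor product consists of finite families in
`QS(ℕ)`, and the coefficient of `x^n` in the image is `h` of the `n`-th member. -/
lemma shaExtend_injective {h : QS k →ₐ[k] R} (hinj : Function.Injective h) :
    Function.Injective (shaExtend h) := by
  rw [injective_iff_map_eq_zero]
  intro s hs
  let E := TensorProduct.equivFinsuppOfBasisLeft (N := QS k) (Polynomial.basisMonomials k)
  rw [← E.map_eq_zero_iff]
  ext n : 1
  rw [Finsupp.zero_apply]
  apply hinj
  rw [map_zero]
  have : h.toLinearMap ∘ₗ Finsupp.lapply n ∘ₗ E.toLinearMap =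
      ((Polynomial.lcoeff R n).restrictScalars k) ∘ₗ (shaExtend h).toLinearMap := by
    refine sha_hom_ext fun i u => ?_
    simp only [LinearMap.comp_apply, AlgHom.toLinearMap_apply, shaExtend_X_pow_tmul,
      LinearEquiv.coe_coe, Finsupp.lapply_apply, E,
      TensorProduct.equivFinsuppOfBasisLeft_apply_tmul_apply,
      LinearMap.restrictScalars_apply, Polynomial.lcoeff_apply, Polynomial.coeff_mul_C,
      Polynomial.coeff_X_pow]
    rw [Polynomial.X_pow_eq_monomial, show Polynomial.monomial i (1 : k) =
      Polynomial.basisMonomials k i by simp, Module.Basis.repr_self, Finsupp.single_apply]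
    by_cases h : i = n
    · simp [h]
    · simp [h, Ne.symm h]
  have := LinearMap.congr_fun this s
  simpa [hs] using this

lemma mem_range_shaExtend_iff {h : QS k →ₐ[k] R} {p : R[X]} :
    p ∈ (shaExtend h).range ↔ ∀ i, p.coeff i ∈ h.range := by
  constructor
  · rintro ⟨s, rfl⟩
    change ∀ i, (shaExtend h s).coeff i ∈ h.range
    induction s using TensorProduct.induction_on with
    | zero =>
      intro i
      rw [map_zero, Polynomial.coeff_zero]
      exact zero_mem _
    | add x y hx hy =>
      intro i
      rw [map_add, Polynomial.coeff_add]
      exact add_mem (hx i) (hy i)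
    | tmul p u =>
      intro i
      induction p using Polynomial.induction_on' with
      | add p q hp hq =>
        rw [TensorProduct.add_tmul, map_add, Polynomial.coeff_add]
        exact add_mem hp hq
      | monomial n a =>
        rw [← Polynomial.smul_X_eq_monomial, ← TensorProduct.smul_tmul', map_smul,
          shaExtend_X_pow_tmul, Polynomial.coeff_smul, Polynomial.coeff_mul_C,
          Polynomial.coeff_X_pow]
        refine Subalgebra.smul_mem _ ?_ _
        split_ifs
        · rw [one_mul]
          exact ⟨u, rfl⟩
        · rw [zero_mul]
          exact zero_mem _
  · intro hp
    rw [p.as_sum_range_C_mul_X_pow]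
    refine sum_mem fun i _ => ?_
    obtain ⟨u, hu⟩ := hp i
    exact ⟨(Polynomial.X ^ i) ⊗ₜ u,
      (shaExtend_X_pow_tmul h i u).trans (by rw [mul_comm, ← hu]; rfl)⟩

lemma mem_subalgebra_of_coeff_mem {T : Subalgebra k R[X]} (hT : (Polynomial.X : R[X]) ∈ T)
    {p : R[X]} (hp : ∀ j, Polynomial.C (p.coeff j) ∈ T) : p ∈ T := by
  rw [p.as_sum_range_C_mul_X_pow]
  exact sum_mem fun j _ => mul_mem (hp j) (pow_mem hT j)

end Extension

/-! ### The image is `LWQSym[t]`, respectively `LWQSym[t, x]` -/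

section Range

variable {k : Type*} [CommRing k]

variable (k) in
/-- The polynomials in `t` with coefficients in `LWQSym`. -/
def LWQSymT : Submodule k (MvPowerSeries ℕ+ k)[X] where
  carrier := {p | ∀ j, p.coeff j ∈ LWQSym k}
  zero_mem' := by intro j; simp
  add_mem' := by
    intro p q hp hq j
    simpa using Submodule.add_mem _ (hp j) (hq j)
  smul_mem' := by
    intro c p hp j
    simpa using Submodule.smul_mem _ c (hp j)

lemma mul_map_C_mem_LWQSymT {p : (MvPowerSeries ℕ+ k)[X]} (hp : p ∈ LWQSymT k) (a : k[X]) :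
    p * a.map MvPowerSeries.C ∈ LWQSymT k := by
  intro j
  rw [Polynomial.coeff_mul]
  refine Submodule.sum_mem _ fun x _ => ?_
  rw [Polynomial.coeff_map, mul_comm, ← MvPowerSeries.smul_eq_C_mul]
  exact Submodule.smul_mem _ _ (hp _)

lemma C_mem_LWQSymT {f : MvPowerSeries ℕ+ k} (hf : f ∈ LWQSym k) :
    Polynomial.C f ∈ LWQSymT k := by
  intro j
  rw [Polynomial.coeff_C]
  split_ifs
  · exact hf
  · exact zero_mem _

variable (k) in
/-- The basis of `QS(ℕ)` given by the words. -/
def wordBasis : Module.Basis (List ℕ) k (QS k) :=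
  Module.Basis.ofRepr (LinearEquiv.refl k (List ℕ →₀ k) : QS k ≃ₗ[k] (List ℕ →₀ k))

lemma wordBasis_apply (α : List ℕ) : wordBasis k α = QS.word α := rfl

variable [Algebra ℚ k] {M : List ℕ → (MvPowerSeries ℕ+ k)[X]}

lemma mem_of_natCast_add_one_smul_mem {V : Type*} [AddCommGroup V] [Module k V]
    {W : Submodule k V} (m : ℕ) {x : V} (h : (m + 1 : k) • x ∈ W) : x ∈ W := by
  obtain ⟨u, hu⟩ := isUnit_natCast_of_ratAlgebra (A := k) m.succ_ne_zero
  rw [← Nat.cast_add_one, ← Nat.succ_eq_add_one, ← hu] at h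
  have := W.smul_mem (↑u⁻¹ : k) h
  rwa [smul_smul, Units.inv_mul, one_smul] at this

/-- Induction on the number of trailing zeros: multiplication by `M_(0)`, a polynomial in `t` over
`k`, yields `m + 1` times the function with one zero more, up to functions with at most `m` trailing
zeros. The factor `m + 1` is invertible. -/
lemma IsRenormalized.mem_LWQSymT (hM : IsRenormalized M) (α : List ℕ) : M α ∈ LWQSymT k := by
  obtain ⟨v, m, hv, rfl⟩ := exists_eq_append_replicate α
  induction m using Nat.strong_induction_on generalizing v with
  | _ m ih =>
  rcases m with _ | m
  · rw [List.replicate_zero, List.append_nil, hM.of_isLeftWeak hv]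
    exact C_mem_LWQSymT (Submodule.subset_span ⟨v, hv, rfl⟩)
  · have h0 : hM.hom (QS.word (v ++ List.replicate m 0) * QS.word [0]) ∈ LWQSymT k := by
      rw [map_mul, hM.hom_word, hM.hom_word, hM.zero]
      exact mul_map_C_mem_LWQSymT (ih m (by omega) v hv) _
    refine mem_of_natCast_add_one_smul_mem m ?_
    rcases eq_or_ne v [] with rfl | hne
    · rw [List.nil_append, word_replicate_mul_word_zero, map_add, map_smul, map_smul,
        hM.hom_word, hM.hom_word] at h0
      have h1 := Submodule.smul_mem _ (m : k) (ih m (by omega) [] hv)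
      rw [List.nil_append] at h1 ⊢
      exact (Submodule.add_mem_iff_left _ h1).1 h0
    · have h1 := word_append_mul_word_zero (k := k) hne hv m
      have h2 : trailingSpan k m ≤ (LWQSymT k).comap hM.hom.toLinearMap := by
        refine Submodule.span_le.2 ?_
        rintro _ ⟨w, j, -, hw, hj, rfl⟩
        change hM.hom _ ∈ LWQSymT k
        rw [hM.hom_word]
        exact ih j (by omega) w hw
      have h3 : hM.hom _ ∈ LWQSymT k := h2 h1
      rw [map_sub, map_smul, hM.hom_word] at h3
      exact (Submodule.sub_mem_iff_right _ h0).1 h3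

lemma IsRenormalized.X_mem_range_hom (hM : IsRenormalized M) :
    (Polynomial.X : (MvPowerSeries ℕ+ k)[X]) ∈ hM.hom.range := by
  refine ⟨-QS.word [0] - algebraMap k _ (algebraMap ℚ k (1 / 2)), ?_⟩
  change hM.hom _ = _
  rw [map_sub, map_neg, hM.hom_word, hM.zero, AlgHom.commutes, shiftedT, Polynomial.map_sub,
    Polynomial.map_neg, Polynomial.map_X, Polynomial.map_C, neg_sub, sub_neg_eq_add]
  exact add_sub_cancel_left _ _

lemma IsRenormalized.mem_range_hom_iff (hM : IsRenormalized M) {p : (MvPowerSeries ℕ+ k)[X]} :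
    p ∈ hM.hom.range ↔ p ∈ LWQSymT k := by
  constructor
  · rintro ⟨u, rfl⟩
    change hM.hom u ∈ LWQSymT k
    have hu : u ∈ Submodule.span k (Set.range (wordBasis k)) := by
      rw [(wordBasis k).span_eq]
      trivial
    induction hu using Submodule.span_induction with
    | mem x hx =>
      obtain ⟨α, rfl⟩ := hx
      rw [wordBasis_apply, hM.hom_word]
      exact hM.mem_LWQSymT α
    | zero => rw [map_zero]; exact zero_mem _
    | add x y _ _ hx hy => rw [map_add]; exact add_mem hx hy
    | smul c x _ hx => rw [map_smul]; exact Submodule.smul_mem _ _ hx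
  · intro hp
    refine mem_subalgebra_of_coeff_mem hM.X_mem_range_hom fun j => ?_
    have hj := hp j
    generalize p.coeff j = f at hj
    induction hj using Submodule.span_induction with
    | mem x hx =>
      obtain ⟨v, hv, rfl⟩ := hx
      exact ⟨QS.word v, (hM.hom_word v).trans (hM.of_isLeftWeak hv)⟩
    | zero => rw [map_zero]; exact zero_mem _
    | add x y _ _ hx hy => rw [map_add]; exact add_mem hx hy
    | smul c x _ hx =>
      rw [← Polynomial.smul_C]
      exact Subalgebra.smul_mem _ hx c

lemma IsRenormalized.toSubmodule_range_shaExtend (hM : IsRenormalized M) :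
    Subalgebra.toSubmodule (shaExtend hM.hom).range = LWQSymTX k := by
  ext p
  rw [Subalgebra.mem_toSubmodule, mem_range_shaExtend_iff]
  simp only [hM.mem_range_hom_iff]
  rfl

/-- The formula does not mention `δ`; this is the independence of the direction. -/
lemma IsRenormalized.ext {M' : List ℕ → (MvPowerSeries ℕ+ k)[X]} (hM : IsRenormalized M)
    (hM' : IsRenormalized M') : M = M' := by
  funext α
  obtain ⟨v, m, hv, rfl⟩ := exists_eq_append_replicate α
  exact ext_monomialCoeff fun μ => (hM v m μ hv).trans (hM' v m μ hv).symm

end Range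

/-! ### Newton's identities and generating series -/

section Newton

variable {B : Type*} [CommRing B]

lemma derivative_rescale (q : B) (f : PowerSeries B) :
    PowerSeries.derivative B (PowerSeries.rescale q f) =
      PowerSeries.C q * PowerSeries.rescale q (PowerSeries.derivative B f) := by
  ext n
  simp only [PowerSeries.coeff_derivative, PowerSeries.coeff_rescale, PowerSeries.coeff_C_mul]
  ring

variable [Algebra ℚ B]

/-- The solution of the recursion `m a_m = ∑_{1 ≤ i ≤ m} r_i a_{m - i}`, `a_0 = 1`, that is, of
Newton's identities; here `r_i` is `r (i - 1)`. -/
def newtonSol (r : ℕ → B) : ℕ → B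
  | 0 => 1
  | m + 1 => ((m + 1 : ℚ)⁻¹) • ∑ i : Fin (m + 1), r i * newtonSol r (m - i)

lemma natCast_mul_inv_smul (m : ℕ) (x : B) : (m + 1 : B) * ((m + 1 : ℚ)⁻¹ • x) = x := by
  have h : (m + 1 : B) = algebraMap ℚ B (m + 1) := by simp
  rw [h, ← Algebra.smul_def, smul_smul, mul_inv_cancel₀ (by positivity), one_smul]

lemma succ_mul_newtonSol_succ (r : ℕ → B) (m : ℕ) :
    (m + 1 : B) * newtonSol r (m + 1) =
      ∑ i ∈ Finset.range (m + 1), r i * newtonSol r (m - i) := by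
  rw [newtonSol, natCast_mul_inv_smul, Finset.sum_range]

lemma eq_newtonSol {r a : ℕ → B} (h0 : a 0 = 1)
    (h : ∀ m : ℕ, (m + 1 : B) * a (m + 1) = ∑ i ∈ Finset.range (m + 1), r i * a (m - i)) (m : ℕ) :
    a m = newtonSol r m := by
  induction m using Nat.strong_induction_on with
  | _ m ih =>
  rcases m with _ | m
  · rw [h0, newtonSol]
  · refine (isUnit_natCast_of_ratAlgebra (A := B) m.succ_ne_zero).mul_left_cancel ?_
    rw [Nat.succ_eq_add_one, Nat.cast_add_one, h, succ_mul_newtonSol_succ]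
    exact Finset.sum_congr rfl fun i _ => by rw [ih (m - i) (by omega)]

lemma map_newtonSol {B' : Type*} [CommRing B'] [Algebra ℚ B'] (f : B →+* B') (r : ℕ → B) (m : ℕ) :
    f (newtonSol r m) = newtonSol (fun i => f (r i)) m := by
  refine eq_newtonSol (a := fun m => f (newtonSol r m)) (by simp [newtonSol]) (fun m => ?_) m
  have := congrArg f (succ_mul_newtonSol_succ r m)
  simpa using this

lemma newtonSol_scale (c : B) (r : ℕ → B) (m : ℕ) :
    c ^ m * newtonSol r m = newtonSol (fun i => c ^ (i + 1) * r i) m := by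
  refine eq_newtonSol (a := fun m => c ^ m * newtonSol r m) (by simp [newtonSol]) (fun m => ?_) m
  rw [mul_left_comm, succ_mul_newtonSol_succ, Finset.mul_sum]
  refine Finset.sum_congr rfl fun i hi => ?_
  have : m + 1 = (i + 1) + (m - i) := by
    have := Finset.mem_range.1 hi
    omega
  rw [this, pow_add]
  ring

/-- The recursion is the differential equation `f' = R f` for the generating series, where `R = ∑
r_i u^i`; its solution is the exponential of the integral of `R`. -/
lemma eq_newtonSol_of_derivative {f : PowerSeries B} {r : ℕ → B}
    (h0 : PowerSeries.constantCoeff f = 1)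
    (h : PowerSeries.derivative B f = PowerSeries.mk r * f) (m : ℕ) :
    PowerSeries.coeff m f = newtonSol r m := by
  refine eq_newtonSol (a := fun m => PowerSeries.coeff m f) (by simpa using h0) (fun m => ?_) m
  have := congrArg (PowerSeries.coeff m) h
  rw [PowerSeries.coeff_derivative, PowerSeries.coeff_mul,
    Finset.Nat.sum_antidiagonal_eq_sum_range_succ_mk] at this
  rw [mul_comm, this]
  simp

lemma derivative_mk_newtonSol (r : ℕ → B) :
    PowerSeries.derivative B (PowerSeries.mk (newtonSol r)) =
      PowerSeries.mk r * PowerSeries.mk (newtonSol r) := by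
  ext m
  rw [PowerSeries.coeff_derivative, PowerSeries.coeff_mul,
    Finset.Nat.sum_antidiagonal_eq_sum_range_succ_mk, PowerSeries.coeff_mk, mul_comm,
    succ_mul_newtonSol_succ]
  simp

/-- Logarithmic derivatives add when series are multiplied. -/
lemma sum_newtonSol_mul (r s : ℕ → B) (m : ℕ) :
    ∑ i ∈ Finset.range (m + 1), newtonSol r i * newtonSol s (m - i) = newtonSol (r + s) m := by
  rw [← eq_newtonSol_of_derivative
    (f := PowerSeries.mk (newtonSol r) * PowerSeries.mk (newtonSol s)) (r := r + s)]
  · rw [PowerSeries.coeff_mul, Finset.Nat.sum_antidiagonal_eq_sum_range_succ_mk]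
    simp
  · simp [newtonSol]
  · have : PowerSeries.mk (r + s) = PowerSeries.mk r + PowerSeries.mk s := by ext; simp
    rw [Derivation.leibniz, derivative_mk_newtonSol, derivative_mk_newtonSol, this]
    simp only [smul_eq_mul]
    ring

lemma sum_alternating_chooseQ (y : B) (m : ℕ) :
    ∑ i ∈ Finset.range (m + 1), (-1) ^ i * y * chooseQ y (m - i) = chooseQ y m * (y - m) := by
  induction m with
  | zero => simp [chooseQ]
  | succ m ih =>
    rw [Finset.sum_range_succ']
    have : ∀ i ∈ Finset.range (m + 1), (-1) ^ (i + 1) * y * chooseQ y (m + 1 - (i + 1)) =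
        -((-1) ^ i * y * chooseQ y (m - i)) := by
      intro i _
      rw [Nat.add_sub_add_right]
      ring
    rw [Finset.sum_congr rfl this, Finset.sum_neg_distrib, ih, ← succ_mul_chooseQ_succ]
    push_cast
    simp only [pow_zero]
    ring

/-- This is the series `(1 + u)^y`, with logarithmic derivative `y / (1 + u)`. -/
lemma chooseQ_eq_newtonSol (y : B) (m : ℕ) :
    chooseQ y m = newtonSol (fun i => (-1) ^ i * y) m :=
  eq_newtonSol (a := chooseQ y) rfl (fun m => by
    rw [succ_mul_chooseQ_succ, sum_alternating_chooseQ]) m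

/-- The elementary symmetric functions of `q, q ^ 2, q ^ 3, …` in terms of the power sums
`f n = q ^ (n + 1) / (1 - q ^ (n + 1))`. -/
theorem prod_eq_newtonSol {q : B} {f : ℕ → B}
    (hq : ∀ (n : ℕ) (w : B), (1 - q ^ (n + 1)) * w = 0 → w = 0)
    (hf : ∀ n, f n * (1 - q ^ (n + 1)) = q ^ (n + 1)) (m : ℕ) :
    ∏ i ∈ Finset.range m, f i = newtonSol (fun i => (-1) ^ i * f i) m := by
  -- `G` plays the role of `∏ (1 + q^i u)` and `P` that of its logarithmic derivative `∑ q^i / (1 +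
  -- q^i u)`, over `i ≥ 1`. These need not converge in `B`, so only their behaviour under `u ↦ qu`
  -- is used.
  set g : ℕ → B := fun m => ∏ i ∈ Finset.range m, f i with hg
  have hgs : ∀ n, g (n + 1) = q ^ (n + 1) * g (n + 1) + q ^ (n + 1) * g n := by
    intro n
    have : g (n + 1) = g n * f n := Finset.prod_range_succ _ _
    rw [this]
    linear_combination g n * hf n
  set G := PowerSeries.mk g with hG
  set P := PowerSeries.mk (fun i => (-1) ^ i * f i) with hP
  set T : PowerSeries B := 1 + PowerSeries.C q * PowerSeries.X with hT
  have coeffT : ∀ (n : ℕ) (h : PowerSeries B), PowerSeries.coeff (n + 1) (T * h) =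
      PowerSeries.coeff (n + 1) h + q * PowerSeries.coeff n h := by
    intro n h
    rw [hT, add_mul, one_mul, map_add, mul_assoc, PowerSeries.coeff_C_mul,
      PowerSeries.coeff_succ_X_mul]
  have coeffT0 : ∀ (h : PowerSeries B), PowerSeries.coeff 0 (T * h) = PowerSeries.coeff 0 h := by
    intro h
    simp [hT]
  have h1 : G = T * PowerSeries.rescale q G := by
    ext n
    rcases n with _ | n
    · rw [coeffT0]
      simp [hG]
    · rw [coeffT, PowerSeries.coeff_rescale, PowerSeries.coeff_rescale, hG, PowerSeries.coeff_mk,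
        PowerSeries.coeff_mk]
      linear_combination hgs n
  have h2 : T * P = PowerSeries.C q * (T * PowerSeries.rescale q P) + PowerSeries.C q := by
    ext n
    rcases n with _ | n
    · rw [map_add, PowerSeries.coeff_C_mul, coeffT0, coeffT0, PowerSeries.coeff_rescale]
      simp only [hP, PowerSeries.coeff_mk, PowerSeries.coeff_zero_C, pow_zero, one_mul]
      linear_combination hf 0
    · rw [map_add, PowerSeries.coeff_C_mul, coeffT, coeffT, PowerSeries.coeff_rescale,
        PowerSeries.coeff_rescale]
      simp only [hP, PowerSeries.coeff_mk, PowerSeries.coeff_C_of_ne_zero (Nat.succ_ne_zero n)]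
      linear_combination (-1) ^ (n + 1) * hf (n + 1) + q * (-1) ^ n * hf n
  set W := PowerSeries.derivative B G - P * G with hW
  have hdT : PowerSeries.derivative B T = PowerSeries.C q := by
    rw [hT, map_add, Derivation.leibniz]
    simp
  -- The defect satisfies `W(u) = q (1 + qu) W(qu)`. Comparing coefficients, each `(1 - q^(n+1))
  -- W_n` is a multiple of the preceding coefficient, so `hq` kills all of them.
  have h3 : W = PowerSeries.C q * (T * PowerSeries.rescale q W) := by
    have e1 : PowerSeries.derivative B G = T * (PowerSeries.C q *
        PowerSeries.rescale q (PowerSeries.derivative B G)) +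
          PowerSeries.rescale q G * PowerSeries.C q := by
      conv_lhs => rw [h1, Derivation.leibniz, derivative_rescale, hdT]
      rfl
    rw [hW, map_sub, map_mul]
    linear_combination e1 - P * h1 - PowerSeries.rescale q G * h2
  have h4 : W = 0 := by
    ext n
    induction n with
    | zero =>
      refine hq 0 _ ?_
      have := congrArg (PowerSeries.coeff 0) h3
      rw [PowerSeries.coeff_C_mul, coeffT0, PowerSeries.coeff_rescale] at this
      linear_combination this
    | succ n ih =>
      refine hq (n + 1) _ ?_
      have := congrArg (PowerSeries.coeff (n + 1)) h3
      rw [PowerSeries.coeff_C_mul, coeffT, PowerSeries.coeff_rescale, PowerSeries.coeff_rescale,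
        ih, map_zero] at this
      linear_combination this
  rw [← eq_newtonSol_of_derivative (f := G) _ (sub_eq_zero.1 h4), hG, PowerSeries.coeff_mk]
  simp [hG, hg]

end Newton

/-! ### Exponential Laurent series and the cancellation of poles -/

section LaurentExp

variable {A : Type*} [CommRing A]

/-- The ring homomorphism between rings of Laurent series induced by a ring homomorphism. -/
def laurentMap {A' : Type*} [CommRing A'] (f : A →+* A') :
    LaurentSeries A →+* LaurentSeries A' where
  toFun x := x.map f
  map_one' := by ext n; simp [HahnSeries.coeff_one, apply_ite f]
  map_mul' x y := HahnSeries.map_mul (f : A →ₙ+* A')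
  map_zero' := by ext n; simp
  map_add' x y := by ext n; simp

lemma coeff_laurentMap {A' : Type*} [CommRing A'] (f : A →+* A') (x : LaurentSeries A) (n : ℤ) :
    (laurentMap f x).coeff n = f (x.coeff n) := rfl

lemma laurentMap_ofPowerSeries {A' : Type*} [CommRing A'] (f : A →+* A') (p : PowerSeries A) :
    laurentMap f (HahnSeries.ofPowerSeries ℤ A p) =
      HahnSeries.ofPowerSeries ℤ A' (PowerSeries.map f p) := by
  ext n
  rw [coeff_laurentMap]
  have h1 := PowerSeries.coeff_coe p n
  have h2 := PowerSeries.coeff_coe (PowerSeries.map f p) n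
  rw [h1, h2]
  split_ifs <;> simp

lemma coeff_mul_eq_zero {x y : LaurentSeries A} {a b : ℤ} (hx : ∀ n < a, x.coeff n = 0)
    (hy : ∀ n < b, y.coeff n = 0) {n : ℤ} (hn : n < a + b) : (x * y).coeff n = 0 := by
  rw [HahnSeries.coeff_mul]
  refine Finset.sum_eq_zero fun ij hij => ?_
  have := (Finset.mem_antidiagonal.1 hij).2.2
  rcases lt_or_ge ij.1 a with h | h
  · rw [hx _ h, zero_mul]
  · rw [hy _ (by omega), mul_zero]

lemma coeff_ofPowerSeries_of_neg (p : PowerSeries A) {n : ℤ} (hn : n < 0) :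
    (HahnSeries.ofPowerSeries ℤ A p).coeff n = 0 := by
  have := PowerSeries.coeff_coe p n
  rwa [if_pos hn] at this

lemma coeff_natCast_add_one_mul (m : ℕ) (x : LaurentSeries A) (n : ℤ) :
    (((m : LaurentSeries A) + 1) * x).coeff n = (m + 1 : A) * x.coeff n := by
  rw [show (m : LaurentSeries A) + 1 = HahnSeries.C (m + 1 : A) by
      rw [map_add, map_natCast, map_one],
    HahnSeries.C_mul_eq_smul, HahnSeries.coeff_smul, smul_eq_mul]

variable [Algebra ℚ A]

/-- The power series `e ^ (s z)`. -/
def expS (s : A) : PowerSeries A := PowerSeries.rescale s (PowerSeries.exp A)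

lemma expS_add (s t : A) : expS (s + t) = expS s * expS t :=
  (PowerSeries.exp_mul_exp_eq_exp_add s t).symm

lemma coeff_expS (s : A) (n : ℕ) :
    PowerSeries.coeff n (expS s) = s ^ n * algebraMap ℚ A (1 / n.factorial) := by
  simp [expS, PowerSeries.coeff_rescale, PowerSeries.coeff_exp]

lemma expS_zero : expS (0 : A) = 1 := by
  ext n
  rw [coeff_expS, PowerSeries.coeff_one]
  rcases n with _ | n <;> simp

lemma expS_pow (s : A) (n : ℕ) : expS s ^ n = expS (n * s) := by
  induction n with
  | zero => simp [expS_zero]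
  | succ n ih => rw [pow_succ, ih, ← expS_add]; push_cast; ring_nf

lemma constantCoeff_expS (s : A) : PowerSeries.constantCoeff (expS s) = 1 := by
  rw [← PowerSeries.coeff_zero_eq_constantCoeff_apply, coeff_expS]
  simp

lemma map_expS {A' : Type*} [CommRing A'] [Algebra ℚ A'] (f : A →+* A') (s : A) :
    PowerSeries.map f (expS s) = expS (f s) := by
  ext n
  rw [PowerSeries.coeff_map, coeff_expS, coeff_expS, map_mul, map_pow]
  congr 1
  exact RingHom.congr_fun (Subsingleton.elim (f.comp (algebraMap ℚ A)) (algebraMap ℚ A')) _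

variable (A) in
/-- The Laurent series `1 / (c z)`. -/
def invZ (c : ℚ) : LaurentSeries A := HahnSeries.single (-1) (algebraMap ℚ A c⁻¹)

lemma invZ_mul_X {c : ℚ} (hc : c ≠ 0) : invZ A c * HahnSeries.ofPowerSeries ℤ A
    (PowerSeries.C (algebraMap ℚ A c) * PowerSeries.X) = 1 := by
  rw [map_mul, HahnSeries.ofPowerSeries_C, HahnSeries.ofPowerSeries_X, HahnSeries.C_apply, invZ,
    HahnSeries.single_mul_single, HahnSeries.single_mul_single, zero_add, mul_one, ← map_mul,
    inv_mul_cancel₀ hc, map_one]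
  rfl

variable (A) in
/-- The power series `z c e ^ (c z) / (e ^ (c z) - 1)`. -/
def bern (c : ℚ) : PowerSeries A :=
  PowerSeries.rescale (algebraMap ℚ A c) (bernoulli'PowerSeries A)

lemma bern_mul (c : ℚ) : bern A c * (expS (algebraMap ℚ A c) - 1) =
    PowerSeries.C (algebraMap ℚ A c) * PowerSeries.X * expS (algebraMap ℚ A c) := by
  have := congrArg (PowerSeries.rescale (algebraMap ℚ A c))
    (bernoulli'PowerSeries_mul_exp_sub_one A)
  rw [map_mul, map_sub, map_one, map_mul, PowerSeries.rescale_X] at this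
  exact this

variable (A) in
/-- The Laurent series `e ^ (c z) / (1 - e ^ (c z))`. -/
def geo (c : ℚ) : LaurentSeries A := -(invZ A c * HahnSeries.ofPowerSeries ℤ A (bern A c))

lemma geo_mul {c : ℚ} (hc : c ≠ 0) :
    geo A c * (1 - HahnSeries.ofPowerSeries ℤ A (expS (algebraMap ℚ A c))) =
      HahnSeries.ofPowerSeries ℤ A (expS (algebraMap ℚ A c)) := by
  have h := congrArg (HahnSeries.ofPowerSeries ℤ A) (bern_mul (A := A) c)
  have h1 := invZ_mul_X (A := A) hc
  rw [map_mul, map_sub, map_one, map_mul] at h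
  rw [geo]
  linear_combination invZ A c * h + HahnSeries.ofPowerSeries ℤ A (expS (algebraMap ℚ A c)) * h1

/-- By `geo_mul`, `1 - e^(cz)` is a unit with inverse `e^(-cz)` times `geo A c`, even if `A` has
zero divisors. -/
lemma eq_zero_of_one_sub_expS_mul {c : ℚ} (hc : c ≠ 0) {w : LaurentSeries A}
    (h : (1 - HahnSeries.ofPowerSeries ℤ A (expS (algebraMap ℚ A c))) * w = 0) : w = 0 := by
  have h1 := geo_mul (A := A) hc
  have h2 : HahnSeries.ofPowerSeries ℤ A (expS (algebraMap ℚ A c)) *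
      HahnSeries.ofPowerSeries ℤ A (expS (-algebraMap ℚ A c)) = 1 := by
    rw [← map_mul, ← expS_add, add_neg_cancel, expS_zero, map_one]
  linear_combination -w * h2 - HahnSeries.ofPowerSeries ℤ A (expS (-algebraMap ℚ A c)) * w * h1 +
    HahnSeries.ofPowerSeries ℤ A (expS (-algebraMap ℚ A c)) * geo A c * h

/-- The Laurent series `e ^ (c s z) e ^ (c z) / (1 - e ^ (c z))` has the polar part `-1 / (c z)` and
the constant term `-s - 1 / 2`. -/
lemma exists_expS_mul_geo {c : ℚ} (hc : c ≠ 0) (s : A) : ∃ h : PowerSeries A,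
    HahnSeries.ofPowerSeries ℤ A (expS (algebraMap ℚ A c * s)) * geo A c + invZ A c =
      HahnSeries.ofPowerSeries ℤ A h ∧
    PowerSeries.constantCoeff h = -s - algebraMap ℚ A (1 / 2) := by
  have hb0 : PowerSeries.constantCoeff (bern A c) = 1 := by
    rw [← PowerSeries.coeff_zero_eq_constantCoeff_apply, bern, PowerSeries.coeff_rescale,
      bernoulli'PowerSeries, PowerSeries.coeff_mk]
    simp
  have hb1 : PowerSeries.coeff 1 (bern A c) = algebraMap ℚ A (c / 2) := by
    rw [bern, PowerSeries.coeff_rescale, bernoulli'PowerSeries, PowerSeries.coeff_mk, pow_one,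
      ← map_mul]
    simp [div_eq_mul_inv]
  -- The sum in question is `1 / (cz)` times this difference, so its constant term is the linear
  -- coefficient `-(cs + c/2)` divided by `c`.
  have hX : PowerSeries.X ∣ 1 - expS (algebraMap ℚ A c * s) * bern A c := by
    rw [PowerSeries.X_dvd_iff, map_sub, map_mul, constantCoeff_expS, hb0]
    simp
  obtain ⟨h, hh⟩ := hX
  refine ⟨PowerSeries.C (algebraMap ℚ A c⁻¹) * h, ?_, ?_⟩
  · have h1 := invZ_mul_X (A := A) hc
    have h2 := congrArg (HahnSeries.ofPowerSeries ℤ A) hh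
    have h3 : HahnSeries.ofPowerSeries ℤ A (PowerSeries.C (algebraMap ℚ A c⁻¹)) *
        HahnSeries.ofPowerSeries ℤ A (PowerSeries.C (algebraMap ℚ A c)) = 1 := by
      rw [← map_mul, ← map_mul, ← map_mul, inv_mul_cancel₀ hc, map_one, map_one, map_one]
    rw [map_mul] at h1
    rw [map_sub, map_one, map_mul, map_mul] at h2
    rw [map_mul, geo]
    linear_combination invZ A c * h2 + HahnSeries.ofPowerSeries ℤ A
      (PowerSeries.C (algebraMap ℚ A c⁻¹)) * HahnSeries.ofPowerSeries ℤ A h * h1 -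
      invZ A c * HahnSeries.ofPowerSeries ℤ A PowerSeries.X * HahnSeries.ofPowerSeries ℤ A h * h3
  · have h1 := congrArg (PowerSeries.coeff 1) hh
    have h2 : PowerSeries.coeff 1 (PowerSeries.X * h) = PowerSeries.constantCoeff h := by
      rw [← zero_add 1, PowerSeries.coeff_succ_X_mul,
        PowerSeries.coeff_zero_eq_constantCoeff_apply]
    rw [h2, map_sub, PowerSeries.coeff_mul, Finset.Nat.sum_antidiagonal_eq_sum_range_succ_mk,
      Finset.sum_range_succ, Finset.sum_range_one] at h1
    simp only [coeff_expS, hb1, Nat.sub_zero, Nat.sub_self, pow_zero, pow_one,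
      PowerSeries.coeff_zero_eq_constantCoeff_apply, hb0, Nat.factorial_zero, Nat.factorial_one,
      Nat.cast_one, div_one, map_one, mul_one, one_mul, PowerSeries.coeff_one, one_ne_zero,
      if_false, zero_sub] at h1
    rw [map_mul, PowerSeries.constantCoeff_C, ← h1, div_eq_mul_inv, map_mul, one_div]
    have h3 : algebraMap ℚ A c⁻¹ * algebraMap ℚ A c = 1 := by
      rw [← map_mul, inv_mul_cancel₀ hc, map_one]
    linear_combination (-s - algebraMap ℚ A 2⁻¹) * h3

variable (A) in
/-- The product of the Laurent series `e ^ (i d z) / (1 - e ^ (i d z))` for `1 ≤ i ≤ m`. -/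
def prodGeo (d : ℚ) (m : ℕ) : LaurentSeries A := ∏ i ∈ Finset.range m, geo A ((i + 1) * d)

variable (A) in
/-- The counterterm of a word of `m` zeros. -/
def polarSeq (d : ℚ) : ℕ → LaurentSeries A := newtonSol fun i => (-1) ^ i * invZ A ((i + 1) * d)

lemma prodGeo_eq_newtonSol {d : ℚ} (hd : d ≠ 0) (m : ℕ) :
    prodGeo A d m = newtonSol (fun i => (-1) ^ i * geo A ((i + 1) * d)) m := by
  have hc : ∀ n : ℕ, ((n + 1) * d : ℚ) ≠ 0 := fun n => mul_ne_zero (by positivity) hd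
  have hq : ∀ n : ℕ, HahnSeries.ofPowerSeries ℤ A (expS (algebraMap ℚ A d)) ^ (n + 1) =
      HahnSeries.ofPowerSeries ℤ A (expS (algebraMap ℚ A ((n + 1) * d))) := by
    intro n
    rw [← map_pow, expS_pow, map_mul, map_add, map_natCast, map_one, Nat.cast_add_one]
  refine prod_eq_newtonSol (q := HahnSeries.ofPowerSeries ℤ A (expS (algebraMap ℚ A d)))
    (f := fun i => geo A ((i + 1) * d)) (fun n w h => ?_) (fun n => ?_) m
  · rw [hq] at h
    exact eq_zero_of_one_sub_expS_mul (hc n) h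
  · rw [hq]
    exact geo_mul (hc n)

/-- Both factors are Newton solutions, so the convolution is the Newton solution of the sum of their
sequences. By `exists_expS_mul_geo` the entries of that sum have no pole and, up to the sign
`(-1)^i`, the common constant term `-s - 1/2`, free of `d`; this is the sequence of a binomial
coefficient. -/
theorem exists_sum_prodGeo_mul_polarSeq {d : ℚ} (hd : d ≠ 0) (s : A) (m : ℕ) :
    ∃ h : PowerSeries A,
      ∑ i ∈ Finset.range (m + 1), HahnSeries.ofPowerSeries ℤ A (expS (algebraMap ℚ A d * s)) ^ i *
        prodGeo A d i * polarSeq A d (m - i) = HahnSeries.ofPowerSeries ℤ A h ∧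
      PowerSeries.constantCoeff h = chooseQ (-s - algebraMap ℚ A (1 / 2)) m := by
  have hc : ∀ n : ℕ, ((n + 1) * d : ℚ) ≠ 0 := fun n => mul_ne_zero (by positivity) hd
  choose h h1 h2 using fun n : ℕ => exists_expS_mul_geo (A := A) (hc n) s
  refine ⟨newtonSol (fun i => (-1) ^ i * h i) m, ?_, ?_⟩
  · rw [map_newtonSol]
    simp only [prodGeo_eq_newtonSol hd, newtonSol_scale, polarSeq]
    rw [sum_newtonSol_mul]
    congr 1
    ext1 i
    rw [Pi.add_apply, map_mul, map_pow, map_neg, map_one, ← h1, ← map_pow, expS_pow]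
    have : ((i + 1 : ℕ) : A) * (algebraMap ℚ A d * s) = algebraMap ℚ A ((i + 1) * d) * s := by
      simp [mul_assoc]
    rw [this]
    ring
  · rw [map_newtonSol, chooseQ_eq_newtonSol]
    simp [h2]

lemma polarSeq_zero (d : ℚ) : polarSeq A d 0 = 1 := by rw [polarSeq, newtonSol]

lemma coeff_invZ_mul (c : ℚ) (x : LaurentSeries A) (n : ℤ) :
    (invZ A c * x).coeff n = algebraMap ℚ A c⁻¹ * x.coeff (n + 1) := by
  rw [invZ, HahnSeries.coeff_single_mul, sub_neg_eq_add]

lemma coeff_polarSeq (d : ℚ) (m : ℕ) {n : ℤ} (hn : 0 ≤ n) :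
    (polarSeq A d (m + 1)).coeff n = 0 := by
  induction m using Nat.strong_induction_on generalizing n with
  | _ m ih =>
  refine (isUnit_natCast_of_ratAlgebra (A := A) m.succ_ne_zero).mul_right_eq_zero.1 ?_
  rw [Nat.succ_eq_add_one, Nat.cast_add_one, ← coeff_natCast_add_one_mul, polarSeq,
    succ_mul_newtonSol_succ, HahnSeries.coeff_sum]
  refine Finset.sum_eq_zero fun i hi => ?_
  -- Multiplication by `invZ` shifts degrees by one, so only positive degrees matter here; there the
  -- initial value 1 vanishes as well.
  have h1 : (newtonSol (fun i => (-1) ^ i * invZ A ((i + 1) * d)) (m - i)).coeff (n + 1) = 0 := by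
    rcases hm : m - i with _ | j
    · rw [newtonSol, HahnSeries.coeff_one, if_neg (by omega)]
    · exact ih j (by omega) (by omega)
  have h2 : ∀ x : LaurentSeries A, x.coeff n = 0 → ((-1) ^ (i : ℕ) * x).coeff n = 0 := by
    intro x hx
    rcases neg_one_pow_eq_or (LaurentSeries A) (i : ℕ) with h | h
    · rw [h, one_mul, hx]
    · rw [h, neg_one_mul, HahnSeries.coeff_neg, hx, neg_zero]
  rw [mul_assoc]
  exact h2 _ (by rw [coeff_invZ_mul, h1, mul_zero])

variable {A' : Type*} [CommRing A'] [Algebra ℚ A']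

lemma laurentMap_invZ (f : A →+* A') (c : ℚ) : laurentMap f (invZ A c) = invZ A' c := by
  ext n
  rw [coeff_laurentMap, invZ, invZ, HahnSeries.coeff_single, HahnSeries.coeff_single, apply_ite f,
    map_zero]
  congr 1
  exact RingHom.congr_fun (Subsingleton.elim (f.comp (algebraMap ℚ A)) (algebraMap ℚ A')) _

lemma laurentMap_polarSeq (f : A →+* A') (d : ℚ) (m : ℕ) :
    laurentMap f (polarSeq A d m) = polarSeq A' d m := by
  rw [polarSeq, polarSeq, map_newtonSol]
  simp [laurentMap_invZ]

lemma laurentMap_geo (f : A →+* A') {c : ℚ} (hc : c ≠ 0) :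
    laurentMap f (geo A c) = geo A' c := by
  have h1 := congrArg (laurentMap f) (geo_mul (A := A) hc)
  rw [map_mul, map_sub, map_one, laurentMap_ofPowerSeries, map_expS,
    show f (algebraMap ℚ A c) = algebraMap ℚ A' c from
      RingHom.congr_fun (Subsingleton.elim (f.comp (algebraMap ℚ A)) (algebraMap ℚ A')) _] at h1
  have h2 := geo_mul (A := A') hc
  rw [← sub_eq_zero]
  refine eq_zero_of_one_sub_expS_mul hc ?_
  linear_combination h1 - h2

lemma laurentMap_prodGeo (f : A →+* A') {d : ℚ} (hd : d ≠ 0) (m : ℕ) :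
    laurentMap f (prodGeo A d m) = prodGeo A' d m := by
  rw [prodGeo, prodGeo, map_prod]
  exact Finset.prod_congr rfl fun i _ => laurentMap_geo f (mul_ne_zero (by positivity) hd)

/-- Each factor has at most a simple pole. The bound shows that the cut-off in `phiZero` loses
nothing. -/
lemma coeff_prodGeo (d : ℚ) (m : ℕ) {n : ℤ} (hn : n < -m) : (prodGeo A d m).coeff n = 0 := by
  induction m generalizing n with
  | zero =>
    rw [prodGeo, Finset.prod_range_zero, HahnSeries.coeff_one, if_neg]
    simp at hn
    omega
  | succ m ih =>
    rw [prodGeo, Finset.prod_range_succ]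
    refine coeff_mul_eq_zero (a := -m) (b := -1) (fun n h => ih h) (fun n h => ?_)
      (by push_cast at hn; omega)
    rw [geo, HahnSeries.coeff_neg, coeff_invZ_mul, coeff_ofPowerSeries_of_neg _ (by omega),
      mul_zero, neg_zero]

end LaurentExp

/-! ### Convergence and uniqueness of Laurent expansions -/

section Convergence

lemma hasSum_of_eq {ι : Type*} {f g : ι → ℂ} {a b : ℂ} (h : HasSum f a) (e : ∀ n, g n = f n)
    (e' : b = a) : HasSum g b := by
  rw [funext e, e']
  exact h

/-- The power series `p` converges to `g` near `0`. -/
def ConvergesTo (p : PowerSeries ℚ) (g : ℂ → ℂ) : Prop :=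
  ∃ r : ℝ, 0 < r ∧ ∀ z : ℂ, ‖z‖ < r →
    HasSum (fun n : ℕ => ((PowerSeries.coeff n p : ℚ) : ℂ) * z ^ n) (g z)

lemma ConvergesTo.mul {p p' : PowerSeries ℚ} {g g' : ℂ → ℂ} (h : ConvergesTo p g)
    (h' : ConvergesTo p' g') : ConvergesTo (p * p') (fun z => g z * g' z) := by
  obtain ⟨r, hr, h⟩ := h
  obtain ⟨r', hr', h'⟩ := h'
  refine ⟨min r r', lt_min hr hr', fun z hz => ?_⟩
  have h1 := h z (hz.trans_le (min_le_left _ _))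
  have h2 := h' z (hz.trans_le (min_le_right _ _))
  have := hasSum_sum_range_mul_of_summable_norm h1.summable.norm h2.summable.norm
  rw [h1.tsum_eq, h2.tsum_eq] at this
  refine hasSum_of_eq this (fun n => ?_) rfl
  rw [PowerSeries.coeff_mul, Finset.Nat.sum_antidiagonal_eq_sum_range_succ_mk, Rat.cast_sum,
    Finset.sum_mul]
  refine Finset.sum_congr rfl fun i hi => ?_
  have : n = i + (n - i) := by
    have := Finset.mem_range.1 hi
    omega
  conv_lhs => rw [this, pow_add]
  push_cast
  rw [Nat.add_sub_cancel_left]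
  ring

lemma convergesTo_expS (c : ℚ) : ConvergesTo (expS c) (fun z => Complex.exp (c * z)) := by
  refine ⟨1, one_pos, fun z _ => ?_⟩
  have := NormedSpace.expSeries_div_hasSum_exp ((c : ℂ) * z)
  rw [← Complex.exp_eq_exp_ℂ] at this
  refine hasSum_of_eq this (fun n => ?_) rfl
  rw [coeff_expS, mul_pow, eq_ratCast, Rat.cast_id]
  push_cast
  ring

lemma convergesTo_C_mul_X (c : ℚ) :
    ConvergesTo (PowerSeries.C c * PowerSeries.X) (fun z => c * z) := by
  refine ⟨1, one_pos, fun z _ => ?_⟩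
  refine hasSum_of_eq (hasSum_single 1 fun n hn => ?_)
    (fun n => by rw [PowerSeries.coeff_C_mul, PowerSeries.coeff_X]) ?_
  · rw [if_neg hn]
    simp
  · simp

lemma ConvergesTo.sum {ι : Type*} (s : Finset ι) {p : ι → PowerSeries ℚ} {g : ι → ℂ → ℂ}
    (h : ∀ i, ConvergesTo (p i) (g i)) :
    ConvergesTo (∑ i ∈ s, p i) (fun z => ∑ i ∈ s, g i z) := by
  classical
  induction s using Finset.induction_on with
  | empty => exact ⟨1, one_pos, fun z _ => by simp⟩
  | insert i s hi ih =>
    obtain ⟨r, hr, h1⟩ := h i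
    obtain ⟨r', hr', h2⟩ := ih
    refine ⟨min r r', lt_min hr hr', fun z hz => ?_⟩
    have := (h1 z (hz.trans_le (min_le_left _ _))).add (h2 z (hz.trans_le (min_le_right _ _)))
    refine hasSum_of_eq this (fun n => ?_) (Finset.sum_insert hi)
    rw [Finset.sum_insert hi, map_add]
    push_cast
    ring

/-- A crude bound that only has to give a positive radius of convergence. In the recursion from
`B(z)(e^z - 1) = z e^z`, the earlier coefficients carry factors `1 / j!` with `j ≥ 2`, at most
`1/2`. -/
lemma abs_coeff_bernoulli_le (n : ℕ) :
    |PowerSeries.coeff n (bernoulli'PowerSeries ℚ)| ≤ 2 ^ n := by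
  induction n using Nat.strong_induction_on with
  | _ n ih =>
  rcases n with _ | n
  · simp [bernoulli'PowerSeries]
  set b := fun n => PowerSeries.coeff n (bernoulli'PowerSeries ℚ) with hb
  have h := congrArg (PowerSeries.coeff (n + 2)) (bernoulli'PowerSeries_mul_exp_sub_one ℚ)
  rw [PowerSeries.coeff_mul, Finset.Nat.sum_antidiagonal_eq_sum_range_succ_mk,
    PowerSeries.coeff_succ_X_mul, Finset.sum_range_succ, Finset.sum_range_succ] at h
  have e1 : n + 2 - (n + 1) = 1 := by omega
  simp only [Nat.sub_self, e1, map_sub, PowerSeries.coeff_exp, PowerSeries.coeff_one] at h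
  norm_num at h
  have e2 : b (n + 1) = 1 / ((n + 1).factorial : ℚ) -
      ∑ i ∈ Finset.range (n + 1), b i * (1 / ((n + 2 - i).factorial : ℚ)) := by
    rw [eq_sub_iff_add_eq, add_comm, one_div, ← h, hb]
    congr 1
    refine Finset.sum_congr rfl fun i hi => ?_
    have := Finset.mem_range.1 hi
    rw [if_neg (by omega), sub_zero, one_div]
  have e3 : |∑ i ∈ Finset.range (n + 1), b i * (1 / ((n + 2 - i).factorial : ℚ))| ≤
      ∑ i ∈ Finset.range (n + 1), (2 : ℚ) ^ i * (1 / 2) := by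
    refine (Finset.abs_sum_le_sum_abs _ _).trans (Finset.sum_le_sum fun i hi => ?_)
    have hi := Finset.mem_range.1 hi
    rw [abs_mul]
    refine mul_le_mul (ih i (by omega)) ?_ (abs_nonneg _) (by positivity)
    rw [abs_of_nonneg (by positivity)]
    refine one_div_le_one_div_of_le (by norm_num) ?_
    have : Nat.factorial 2 ≤ (n + 2 - i).factorial := Nat.factorial_le (by omega)
    exact_mod_cast this
  have e4 : ∑ i ∈ Finset.range (n + 1), (2 : ℚ) ^ i * (1 / 2) = (2 ^ (n + 1) - 1) / 2 := by
    rw [← Finset.sum_mul, geom_sum_eq (by norm_num)]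
    norm_num
    ring
  have e5 : |1 / ((n + 1).factorial : ℚ)| ≤ 1 := by
    rw [abs_of_nonneg (by positivity), div_le_one (by positivity)]
    exact_mod_cast (n + 1).factorial_pos
  have e6 : (2 : ℚ) ≤ 2 ^ (n + 1) := by
    rw [pow_succ]
    have : (1 : ℚ) ≤ 2 ^ n := one_le_pow₀ (by norm_num)
    linarith
  change |b (n + 1)| ≤ _
  rw [e2]
  refine (abs_sub _ _).trans ?_
  rw [e4] at e3
  linarith

lemma bern_mul_rat (c : ℚ) :
    bern ℚ c * (expS c - 1) = PowerSeries.C c * PowerSeries.X * expS c :=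
  bern_mul c

lemma exists_convergesTo_bern (c : ℚ) : ∃ g, ConvergesTo (bern ℚ c) g := by
  -- The coefficients are at most `(2|c|)^n` in absolute value; adding 1 to `|c|` keeps the radius
  -- meaningful for `c = 0`.
  refine ⟨fun z => ∑' n : ℕ, ((PowerSeries.coeff n (bern ℚ c) : ℚ) : ℂ) * z ^ n,
    1 / (2 * (|(c : ℝ)| + 1)), by positivity, fun z hz => Summable.hasSum ?_⟩
  have hpos : 0 < 2 * (|(c : ℝ)| + 1) := by positivity
  have hlt : 2 * (|(c : ℝ)| + 1) * ‖z‖ < 1 := by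
    rw [lt_div_iff₀ hpos] at hz
    linarith
  refine Summable.of_norm_bounded (summable_geometric_of_lt_one (by positivity) hlt) fun n => ?_
  rw [norm_mul, norm_pow, mul_pow]
  refine mul_le_mul_of_nonneg_right ?_ (by positivity)
  rw [bern, PowerSeries.coeff_rescale, eq_ratCast, Rat.cast_id]
  have h1 : |((PowerSeries.coeff n (bernoulli'PowerSeries ℚ) : ℚ) : ℝ)| ≤ 2 ^ n := by
    exact_mod_cast abs_coeff_bernoulli_le n
  push_cast
  rw [norm_mul, norm_pow, mul_pow, mul_comm]
  have h2 : ∀ x : ℚ, ‖(x : ℂ)‖ = |(x : ℝ)| := fun x => by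
    rw [← Complex.ofReal_ratCast, Complex.norm_real, Real.norm_eq_abs]
  rw [h2, h2]
  exact mul_le_mul h1 (pow_le_pow_left₀ (abs_nonneg _) (by linarith) n) (by positivity)
    (by positivity)

/-- The series is continuous on a closed interval ending at 0, by domination by its terms at `r /
2`, so its value at 0 is the limit from the negative reals, the side where `Re z < 0`. -/
lemma hasSum_zero_coeff {a : ℕ → ℂ} {r : ℝ} (hr : 0 < r)
    (h : ∀ x : ℝ, 0 < x → x < r → HasSum (fun n => a n * (-x : ℂ) ^ n) 0) : a 0 = 0 := by
  set ρ := r / 2 with hρ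
  have hρ0 : 0 < ρ := by positivity
  have hs := (h ρ hρ0 (by rw [hρ]; linarith)).summable.norm
  have hcont : ContinuousOn (fun x : ℝ => ∑' n, a n * (-x : ℂ) ^ n) (Set.Icc 0 ρ) := by
    refine continuousOn_tsum (fun n => by fun_prop) hs fun n x hx => ?_
    rw [norm_mul, norm_mul, norm_pow, norm_pow, norm_neg, norm_neg, Complex.norm_real,
      Complex.norm_real, Real.norm_of_nonneg hx.1, Real.norm_of_nonneg hρ0.le]
    exact mul_le_mul_of_nonneg_left (pow_le_pow_left₀ hx.1 hx.2 n) (norm_nonneg _)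
  have h0 : (fun x : ℝ => ∑' n, a n * (-x : ℂ) ^ n) 0 = a 0 := by
    change ∑' n, a n * (-((0 : ℝ) : ℂ)) ^ n = a 0
    rw [tsum_eq_single 0]
    · simp
    · intro n hn
      simp [hn]
  have h1 : Filter.Tendsto (fun x : ℝ => ∑' n, a n * (-x : ℂ) ^ n) (nhdsWithin 0 (Set.Ioo 0 ρ))
      (nhds (a 0)) := by
    rw [← h0]
    exact (hcont 0 ⟨le_rfl, hρ0.le⟩).mono_left (nhdsWithin_mono _ Set.Ioo_subset_Icc_self)
  have h2 : Filter.Tendsto (fun x : ℝ => ∑' n, a n * (-x : ℂ) ^ n) (nhdsWithin 0 (Set.Ioo 0 ρ))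
      (nhds 0) := by
    refine Filter.Tendsto.congr' ?_ tendsto_const_nhds
    filter_upwards [self_mem_nhdsWithin] with x hx
    exact (h x hx.1 (by rw [hρ] at hx; linarith [hx.2])).tsum_eq.symm
  have : (nhdsWithin (0 : ℝ) (Set.Ioo 0 ρ)).NeBot := by
    rw [nhdsWithin_Ioo_eq_nhdsGT hρ0]
    infer_instance
  exact tendsto_nhds_unique h1 h2

/-- Otherwise, dividing the difference by `z` to its order gives a power series that vanishes on
small negative reals but has a nonzero constant term. -/
lemma IsLaurentExpansion.unique {c c' : LaurentSeries ℚ} {f : ℂ → ℂ}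
    (h : IsLaurentExpansion c f) (h' : IsLaurentExpansion c' f) : c = c' := by
  by_contra hne
  obtain ⟨r, hr, h⟩ := h
  obtain ⟨r', hr', h'⟩ := h'
  set e := c - c' with he
  have he0 : e ≠ 0 := sub_ne_zero.2 hne
  refine he0 (HahnSeries.coeff_order_eq_zero.1 ?_)
  have key : ((e.coeff (e.order + (0 : ℕ)) : ℚ) : ℂ) = 0 := by
    refine hasSum_zero_coeff (a := fun n : ℕ => ((e.coeff (e.order + n) : ℚ) : ℂ))
      (lt_min hr hr') fun x hx0 hx => ?_
    have hz : (-x : ℂ) ≠ 0 := by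
      rw [neg_ne_zero]
      exact_mod_cast hx0.ne'
    have hn : ‖(-x : ℂ)‖ = x := by
      rw [norm_neg, Complex.norm_real, Real.norm_of_nonneg hx0.le]
    have hre : (-x : ℂ).re < 0 := by simpa using hx0
    have h1 := (h (-x) hre (by rw [hn]; exact hx.trans_le (min_le_left _ _))).sub
      (h' (-x) hre (by rw [hn]; exact hx.trans_le (min_le_right _ _)))
    rw [sub_self] at h1
    have h2 : HasSum (fun n : ℤ => ((e.coeff n : ℚ) : ℂ) * (-x : ℂ) ^ n) 0 := by
      refine hasSum_of_eq h1 (fun n => ?_) rfl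
      rw [he, HahnSeries.coeff_sub]
      push_cast
      ring
    have inj : Function.Injective fun n : ℕ => e.order + (n : ℤ) := fun a b hab => by
      simpa using hab
    rw [← inj.hasSum_iff] at h2
    · have h3 := h2.mul_left ((-x : ℂ) ^ (-e.order))
      rw [mul_zero] at h3
      refine hasSum_of_eq h3 (fun n => ?_) rfl
      rw [Function.comp_apply, mul_left_comm, ← zpow_add₀ hz]
      simp
    · intro n hn
      have : n < e.order := by
        by_contra hle
        exact hn ⟨(n - e.order).toNat, by simp; omega⟩
      rw [HahnSeries.coeff_eq_zero_of_lt_order this]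
      simp
  simpa using key

/-- The Laurent series `c` has a pole of order at most `n` and converges to `f` on the part of a
punctured neighbourhood of `0` where `Re z < 0`. -/
def LaurentConvergesTo (c : LaurentSeries ℚ) (f : ℂ → ℂ) : Prop :=
  ∃ (n : ℕ) (p : PowerSeries ℚ) (g : ℂ → ℂ),
    HahnSeries.single (n : ℤ) 1 * c = HahnSeries.ofPowerSeries ℤ ℚ p ∧ ConvergesTo p g ∧
    ∃ r : ℝ, 0 < r ∧ ∀ z : ℂ, z.re < 0 → ‖z‖ < r → z ^ n * f z = g z

lemma ConvergesTo.laurent {p : PowerSeries ℚ} {g : ℂ → ℂ} (h : ConvergesTo p g) :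
    LaurentConvergesTo (HahnSeries.ofPowerSeries ℤ ℚ p) g :=
  ⟨0, p, g, one_mul _, h, 1, one_pos, fun z _ _ => by rw [pow_zero, one_mul]⟩

lemma LaurentConvergesTo.mul {c c' : LaurentSeries ℚ} {f f' : ℂ → ℂ}
    (h : LaurentConvergesTo c f) (h' : LaurentConvergesTo c' f') :
    LaurentConvergesTo (c * c') (fun z => f z * f' z) := by
  obtain ⟨n, p, g, hp, hg, r, hr, hz⟩ := h
  obtain ⟨n', p', g', hp', hg', r', hr', hz'⟩ := h'
  refine ⟨n + n', p * p', _, ?_, hg.mul hg', min r r', lt_min hr hr', fun z h0 h1 => ?_⟩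
  · have : (HahnSeries.single ((n + n' : ℕ) : ℤ) 1 : LaurentSeries ℚ) =
        HahnSeries.single (n : ℤ) 1 * HahnSeries.single (n' : ℤ) 1 := by
      rw [HahnSeries.single_mul_single, mul_one, Nat.cast_add]
    rw [map_mul, this, ← hp, ← hp']
    ring
  · change z ^ (n + n') * (f z * f' z) = g z * g' z
    rw [← hz z h0 (h1.trans_le (min_le_left _ _)), ← hz' z h0 (h1.trans_le (min_le_right _ _))]
    ring

lemma LaurentConvergesTo.isLaurentExpansion {c : LaurentSeries ℚ} {f : ℂ → ℂ}
    (h : LaurentConvergesTo c f) : IsLaurentExpansion c f := by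
  obtain ⟨k, p, g, hp, ⟨r, hr, hg⟩, r', hr', hz⟩ := h
  refine ⟨min r r', lt_min hr hr', fun z h0 h1 => ?_⟩
  have hz0 : z ≠ 0 := by
    rintro rfl
    simp at h0
  have hs := (hg z (h1.trans_le (min_le_left _ _))).mul_left (z ^ (-k : ℤ))
  rw [← hz z h0 (h1.trans_le (min_le_right _ _)), ← mul_assoc, ← zpow_natCast, ← zpow_add₀ hz0,
    neg_add_cancel, zpow_zero, one_mul] at hs
  have hc : ∀ n : ℤ, c.coeff n = (HahnSeries.ofPowerSeries ℤ ℚ p).coeff (n + k) := by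
    intro n
    rw [← hp, HahnSeries.coeff_single_mul, one_mul, add_sub_cancel_right]
  have inj : Function.Injective fun n : ℕ => (n : ℤ) - k := fun a b hab => by
    simpa using hab
  rw [← inj.hasSum_iff]
  · refine hasSum_of_eq hs (fun n => ?_) rfl
    rw [Function.comp_apply, hc, sub_add_cancel, HahnSeries.ofPowerSeries_apply_coeff,
      mul_left_comm, ← zpow_natCast, ← zpow_add₀ hz0]
    ring_nf
  · intro n hn
    have : n + k < 0 := by
      by_contra hle
      exact hn ⟨(n + k).toNat, by simp; omega⟩
    rw [hc, coeff_ofPowerSeries_of_neg _ this]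
    simp

lemma LaurentConvergesTo.laurentExpansion_eq {c : LaurentSeries ℚ} {f : ℂ → ℂ}
    (h : LaurentConvergesTo c f) : laurentExpansion f = c := by
  have hex : ∃ c, IsLaurentExpansion c f := ⟨c, h.isLaurentExpansion⟩
  rw [laurentExpansion, dif_pos hex]
  exact hex.choose_spec.unique h.isLaurentExpansion

/-- The sum `g` of `bern ℚ c` satisfies `g(z)(e^(cz) - 1) = cz e^(cz)`. For `Re z < 0` and `c > 0`
the modulus of `e^(cz)` is below 1, so the equation can be divided. -/
lemma laurentConvergesTo_geo {c : ℚ} (hc : 0 < c) : LaurentConvergesTo (geo ℚ c)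
    (fun z => Complex.exp (c * z) / (1 - Complex.exp (c * z))) := by
  obtain ⟨g, hg⟩ := exists_convergesTo_bern c
  have hc0 : (c : ℂ) ≠ 0 := by exact_mod_cast hc.ne'
  obtain ⟨r, hr, h1⟩ := hg
  obtain ⟨r1, hr1, h2⟩ := (ConvergesTo.mul ⟨r, hr, h1⟩ (convergesTo_expS c))
  obtain ⟨r2, hr2, h3⟩ := (convergesTo_C_mul_X c).mul (convergesTo_expS c)
  refine ⟨1, PowerSeries.C (-c⁻¹) * bern ℚ c, fun z => -(c : ℂ)⁻¹ * g z, ?_, ?_,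
    min r (min r1 r2), lt_min hr (lt_min hr1 hr2), fun z h0 hz => ?_⟩
  · rw [map_mul, HahnSeries.ofPowerSeries_C, geo, invZ, mul_neg, ← mul_assoc,
      HahnSeries.single_mul_single, map_neg, neg_mul]
    rw [Nat.cast_one, add_neg_cancel, one_mul, Algebra.algebraMap_self, RingHom.id_apply]
    rfl
  · refine ⟨r, hr, fun z hz => ?_⟩
    refine hasSum_of_eq ((h1 z hz).mul_left (-(c : ℂ)⁻¹)) (fun n => ?_) rfl
    rw [PowerSeries.coeff_C_mul]
    push_cast
    ring
  · have hz1 := h1 z (hz.trans_le (min_le_left _ _))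
    have hz2 := h2 z (hz.trans_le (by simp))
    have hne : Complex.exp (c * z) ≠ 1 := by
      intro h
      have := congrArg norm h
      rw [Complex.norm_exp, norm_one, Real.exp_eq_one_iff] at this
      have h5 : ((c : ℂ) * z).re = c * z.re := by
        rw [← Complex.ofReal_ratCast, Complex.re_ofReal_mul]
      rw [h5] at this
      have : (c : ℝ) * z.re < 0 := mul_neg_of_pos_of_neg (by exact_mod_cast hc) h0
      linarith
    have h4 := (hz2.sub hz1).unique (hasSum_of_eq (h3 z (hz.trans_le (by simp))) (fun n => by
      rw [← bern_mul_rat c, mul_sub, mul_one, map_sub]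
      push_cast
      ring) rfl)
    have hne' : 1 - Complex.exp (c * z) ≠ 0 := sub_ne_zero.2 hne.symm
    change g z * Complex.exp (c * z) - g z = c * z * Complex.exp (c * z) at h4
    change z ^ 1 * (Complex.exp (c * z) / (1 - Complex.exp (c * z))) = -(c : ℂ)⁻¹ * g z
    have hinv : (c : ℂ)⁻¹ * c = 1 := inv_mul_cancel₀ hc0
    rw [pow_one, ← mul_div_assoc, div_eq_iff hne']
    linear_combination (-(c : ℂ)⁻¹) * h4 - z * Complex.exp (c * z) * hinv

end Convergence

/-! ### Evaluation of the regularized sums -/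

section Regularized

/-- The last entry of a list, or `0` if the list is empty. -/
def lastN (I : List ℕ+) : ℕ := (I.getLast?.map fun i : ℕ+ => (i : ℕ)).getD 0

lemma lastN_nil : lastN [] = 0 := rfl

lemma lastN_concat (I : List ℕ+) (i : ℕ+) : lastN (I ++ [i]) = i := by simp [lastN]

lemma le_lastN {I : List ℕ+} (h : I.Pairwise (· < ·)) {i : ℕ+} (hi : i ∈ I) :
    (i : ℕ) ≤ lastN I := by
  rcases List.eq_nil_or_concat' I with rfl | ⟨I, j, rfl⟩
  · simp at hi
  rw [lastN_concat]
  rcases List.mem_append.1 hi with h' | h'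
  · exact_mod_cast ((List.pairwise_append.1 h).2.2 i h' j (by simp)).le
  · simp_all

/-- The sum of the entries of a list of positive integers. -/
def sumN (I : List ℕ+) : ℕ := (I.map fun i : ℕ+ => (i : ℕ)).sum

lemma sumN_concat (I : List ℕ+) (i : ℕ+) : sumN (I ++ [i]) = sumN I + i := by simp [sumN]

lemma lastN_eq_top {v : List ℕ} (hv : IsLeftWeak v) {μ : ℕ+ →₀ ℕ} (I : Idx v μ) :
    lastN I.1 = top μ := by
  obtain ⟨I, hs, hl, he⟩ := I
  rcases List.eq_nil_or_concat' I with rfl | ⟨I, i, rfl⟩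
  · subst he
    change lastN [] = top _
    rw [expo_nil_left, top_zero, lastN_nil]
  rcases List.eq_nil_or_concat' v with rfl | ⟨v, a, rfl⟩
  · simp at hl
  rw [lastN_concat]
  exact getLast_eq_top hv hs (by simpa using hl) he

/-- Appending an index to a term, for a word extended by `0`. -/
def idxSnoc (α : List ℕ) (μ : ℕ+ →₀ ℕ) (x : Idx α μ × ℕ) : Idx (α ++ [0]) μ :=
  -- The new index is the last one plus `n + 1`; the value `lastN [] = 0` lets it be any positive
  -- integer after the empty term.
  ⟨x.1.1 ++ [(lastN x.1.1 + x.2).succPNat], by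
    obtain ⟨⟨I, hs, hl, he⟩, n⟩ := x
    refine ⟨?_, by simp [hl],
      (expo_concat hl _ _).trans (by rw [Finsupp.single_zero, add_zero, he])⟩
    rw [List.pairwise_append]
    refine ⟨hs, List.pairwise_singleton _ _, fun i hi j hj => ?_⟩
    obtain rfl := List.mem_singleton.1 hj
    rw [← PNat.coe_lt_coe, Nat.succPNat_coe]
    have := le_lastN hs hi
    change (i : ℕ) < lastN I + n + 1
    omega⟩

lemma idxSnoc_bijective (α : List ℕ) (μ : ℕ+ →₀ ℕ) : Function.Bijective (idxSnoc α μ) := by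
  constructor
  · rintro ⟨I, n⟩ ⟨J, m⟩ h
    have h := congrArg Subtype.val h
    simp only [idxSnoc] at h
    obtain ⟨h1, h2⟩ := List.append_inj' h rfl
    have h3 : I = J := Subtype.ext h1
    subst h3
    have h4 := congrArg (fun i : ℕ+ => (i : ℕ)) (List.singleton_injective h2)
    simp only [Nat.succPNat_coe] at h4
    rw [Prod.mk.injEq]
    exact ⟨rfl, by omega⟩
  · rintro ⟨I, hs, hl, he⟩
    rcases List.eq_nil_or_concat' I with rfl | ⟨I, i, rfl⟩
    · simp at hl
    have hl' : I.length = α.length := by simpa using hl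
    rw [expo_concat hl', Finsupp.single_zero, add_zero] at he
    have hs' := List.pairwise_append.1 hs
    have hlt : lastN I < i := by
      rcases List.eq_nil_or_concat' I with rfl | ⟨I, j, rfl⟩
      · exact i.pos
      · rw [lastN_concat]
        exact_mod_cast hs'.2.2 j (by simp) i (by simp)
    refine ⟨⟨⟨I, hs'.1, hl', he⟩, i - 1 - lastN I⟩, Subtype.ext ?_⟩
    simp only [idxSnoc]
    congr 2
    apply PNat.eq
    rw [Nat.succPNat_coe]
    omega

lemma hasSum_mul_complex {ι κ : Type*} {f : ι → ℂ} {g : κ → ℂ} {s t : ℂ} (hf : HasSum f s)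
    (hg : HasSum g t) : HasSum (fun x : ι × κ => f x.1 * g x.2) (s * t) :=
  hf.mul hg (summable_mul_of_summable_norm hf.summable.norm hg.summable.norm)

/-- Summation over the last index is a geometric series in `q^(c+1)` and leaves the factor `q^((c+1)
l)`, where `l` is the preceding index. The extra weight `c` on the last index makes the induction
close. -/
lemma hasSum_idx_append {v : List ℕ} (hv : IsLeftWeak v) (μ : ℕ+ →₀ ℕ) {q : ℂ} (hq : ‖q‖ < 1)
    (m c : ℕ) : HasSum (fun I : Idx (v ++ List.replicate m 0) μ => q ^ (sumN I.1 + c * lastN I.1))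
      ((∑' I : Idx v μ, q ^ sumN I.1) * (q ^ ((c + m) * top μ) *
        ∏ i ∈ Finset.range m, q ^ (c + i + 1) / (1 - q ^ (c + i + 1)))) := by
  induction m generalizing c with
  | zero =>
    have := finite_idx hv μ
    have h : HasSum (fun I : Idx v μ => q ^ sumN I.1) (∑' I : Idx v μ, q ^ sumN I.1) :=
      (Summable.of_finite).hasSum
    have e : v ++ List.replicate 0 0 = v := by simp
    rw [e]
    refine hasSum_of_eq (h.mul_right (q ^ (c * top μ))) (fun I => ?_) (by simp)
    rw [lastN_eq_top hv, pow_add]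
  | succ m ih =>
    have h1 := ih (c + 1)
    have hq1 : ‖q ^ (c + 1)‖ < 1 := by
      rw [norm_pow]
      exact pow_lt_one₀ (norm_nonneg _) hq (Nat.succ_ne_zero c)
    have h2 := (hasSum_geometric_of_norm_lt_one hq1).mul_left (q ^ (c + 1))
    have h3 := hasSum_mul_complex h1 h2
    have e : v ++ List.replicate (m + 1) 0 = v ++ List.replicate m 0 ++ [0] := by
      rw [List.replicate_succ', List.append_assoc]
    rw [e, ← (Equiv.ofBijective _ (idxSnoc_bijective (v ++ List.replicate m 0) μ)).hasSum_iff]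
    refine hasSum_of_eq h3 (fun x => ?_) ?_
    · simp only [Function.comp_apply, Equiv.ofBijective_apply, idxSnoc, sumN_concat, lastN_concat,
        Nat.succPNat_coe]
      rw [← pow_mul, ← pow_add, ← pow_add]
      congr 1
      rw [Nat.succ_eq_add_one]
      ring
    · rw [Finset.prod_range_succ']
      have : ∀ i, c + 1 + i + 1 = c + (i + 1) + 1 := fun i => by ring
      simp only [this, add_zero]
      rw [show c + 1 + m = c + (m + 1) by ring, div_eq_mul_inv _ (1 - q ^ (c + 1))]
      ring

lemma regCoeff_map (δ : ℕ+) (α : List ℕ) (μ : ℕ+ →₀ ℕ) (z : ℂ) :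
    regCoeff (α.map fun a => (a, δ)) μ z =
      ∑' I : Idx α μ, Complex.exp ((δ : ℕ) * z) ^ sumN I.1 := by
  have h1 : (α.map fun a => (a, δ)).map Prod.fst = α := by simp [Function.comp_def]
  have h2 : (α.map fun a => (a, δ)).map Prod.snd = List.replicate α.length δ := by
    simp [Function.comp_def]
  rw [regCoeff, h2]
  -- The index type depends on the list, so the equality of lists is generalized before it is
  -- substituted.
  have h3 : ∀ (β : List ℕ) (_ : β = α), ∑' I : Idx β μ, Complex.exp
      (((List.zipWith (fun i b : ℕ+ => (i : ℂ) * (b : ℂ)) I.1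
        (List.replicate α.length δ)).sum) * z) =
      ∑' I : Idx α μ, Complex.exp ((δ : ℕ) * z) ^ sumN I.1 := by
    rintro β rfl
    refine tsum_congr fun I => ?_
    obtain ⟨I, hs, hl, he⟩ := I
    change Complex.exp ((List.zipWith (fun i b : ℕ+ => (i : ℂ) * (b : ℂ)) I
      (List.replicate β.length δ)).sum * z) = Complex.exp ((δ : ℕ) * z) ^ sumN I
    rw [← hl, ← Complex.exp_nat_mul]
    congr 1
    have h4 : (List.zipWith (fun i b : ℕ+ => (i : ℂ) * (b : ℂ)) I
        (List.replicate I.length δ)).sum = (sumN I : ℂ) * (δ : ℕ) := by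
      clear hs hl he
      induction I with
      | nil => simp [sumN]
      | cons i I ih =>
        rw [List.length_cons, List.replicate_succ, List.zipWith_cons_cons, List.sum_cons, ih]
        simp [sumN]
        ring
    rw [h4]
    ring
  exact h3 _ h1

/-- The Laurent expansion of the regularized sums. -/
theorem exists_laurentExpansion_regCoeff (δ : ℕ+) {v : List ℕ} (hv : IsLeftWeak v)
    (μ : ℕ+ →₀ ℕ) : ∃ E : PowerSeries ℚ, PowerSeries.constantCoeff E = Nat.card (Idx v μ) ∧
      (v = [] → E = PowerSeries.C (Nat.card (Idx v μ) : ℚ)) ∧ ∀ m : ℕ, laurentExpansion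
        (regCoeff ((v ++ List.replicate m 0).map fun a => (a, δ)) μ) =
          HahnSeries.ofPowerSeries ℤ ℚ E * HahnSeries.ofPowerSeries ℤ ℚ
            (expS ((δ : ℕ) * top μ : ℚ)) ^ m * prodGeo ℚ (δ : ℕ) m := by
  have := finite_idx hv μ
  have := Fintype.ofFinite (Idx v μ)
  -- The left weak part contributes a finite sum of exponentials, whose constant term is the number
  -- of its terms.
  have hE := ConvergesTo.sum (Finset.univ : Finset (Idx v μ))
    fun I => convergesTo_expS ((δ : ℕ) * sumN I.1 : ℚ)
  refine ⟨∑ I : Idx v μ, expS ((δ : ℕ) * sumN I.1 : ℚ), ?_, ?_,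
    fun m => LaurentConvergesTo.laurentExpansion_eq ?_⟩
  rotate_left 2
  · have hP : ∀ m : ℕ, LaurentConvergesTo (prodGeo ℚ (δ : ℕ) m) (fun z =>
        ∏ i ∈ Finset.range m, Complex.exp (((i + 1) * (δ : ℕ) : ℚ) * z) /
          (1 - Complex.exp (((i + 1) * (δ : ℕ) : ℚ) * z))) := by
      intro m
      induction m with
      | zero =>
        have := (convergesTo_expS 0).laurent
        simpa [prodGeo, expS_zero] using this
      | succ m ih =>
        have h0 : (0 : ℚ) < (m + 1) * (δ : ℕ) := by
          have := δ.pos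
          positivity
        have := ih.mul (laurentConvergesTo_geo h0)
        simp only [prodGeo, Finset.prod_range_succ] at this ⊢
        exact this
    have h1 := ((hE.laurent).mul (convergesTo_expS (m * ((δ : ℕ) * top μ) : ℚ)).laurent).mul (hP m)
    rw [← map_pow, expS_pow]
    obtain ⟨n, p, g, hp, hg, r, hr, hz⟩ := h1
    refine ⟨n, p, g, hp, hg, r, hr, fun z h0 hzr => ?_⟩
    rw [← hz z h0 hzr, regCoeff_map]
    congr 1
    have hq : ‖Complex.exp ((δ : ℕ) * z)‖ < 1 := by
      rw [Complex.norm_exp, Real.exp_lt_one_iff, ← Complex.ofReal_natCast, Complex.re_ofReal_mul]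
      exact mul_neg_of_pos_of_neg (by exact_mod_cast δ.pos) h0
    have h2 := (hasSum_idx_append hv μ hq m 0).tsum_eq
    simp only [zero_mul, add_zero, zero_add] at h2
    rw [h2, tsum_fintype, ← mul_assoc]
    congr 1
    · congr 1
      · refine Finset.sum_congr rfl fun I _ => ?_
        rw [← Complex.exp_nat_mul]
        push_cast
        ring_nf
      · rw [← Complex.exp_nat_mul]
        push_cast
        ring_nf
    · refine Finset.prod_congr rfl fun i _ => ?_
      rw [← Complex.exp_nat_mul]
      push_cast
      ring_nf
  · rw [map_sum]
    simp [constantCoeff_expS, Nat.card_eq_fintype_card]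
  · rintro rfl
    have : ∀ I : Idx [] μ, expS ((δ : ℕ) * sumN I.1 : ℚ) = 1 := by
      rintro ⟨I, hs, hl, he⟩
      have h0 : sumN I = 0 := by
        rw [List.length_eq_zero_iff.1 hl]
        rfl
      change expS ((δ : ℕ) * sumN I : ℚ) = 1
      rw [h0, Nat.cast_zero, mul_zero, expS_zero]
    simp [this, Nat.card_eq_fintype_card]

end Regularized

/-! ### The Birkhoff factorization in a constant direction -/

section Birkhoff

variable {k : Type*} [CommRing k]

/-- The coefficient in `k[t]((z))` of a monomial in the variables `X` of an element of
`k[[X]][t]((z))`. -/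
def laurentCoeff (μ : ℕ+ →₀ ℕ) :
    LaurentSeries (MvPowerSeries ℕ+ k)[X] →+ LaurentSeries k[X] where
  toFun x := x.map (monomialCoeff μ)
  map_zero' := by ext1; ext1 n; exact map_zero (monomialCoeff μ)
  map_add' x y := by ext1; ext1 n; exact map_add (monomialCoeff μ) _ _

lemma coeff_laurentCoeff (μ : ℕ+ →₀ ℕ) (x : LaurentSeries (MvPowerSeries ℕ+ k)[X]) (n : ℤ) :
    (laurentCoeff μ x).coeff n = monomialCoeff μ (x.coeff n) := rfl

lemma ext_laurentCoeff {x y : LaurentSeries (MvPowerSeries ℕ+ k)[X]}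
    (h : ∀ μ, laurentCoeff μ x = laurentCoeff μ y) : x = y := by
  ext1
  ext1 n
  refine ext_monomialCoeff fun μ => ?_
  rw [← coeff_laurentCoeff, h, coeff_laurentCoeff]

variable (k) in
/-- The inclusion of `k[t]` into `k[[X]][t]`. -/
def inclT : k[X] →+* (MvPowerSeries ℕ+ k)[X] := Polynomial.mapRingHom MvPowerSeries.C

/-- Extraction of a coefficient is not multiplicative, but it is linear over series free of the
variables `X`. This suffices, since the counterterms and the factors `e^(btz)` are of that kind. -/
lemma laurentCoeff_mul (μ : ℕ+ →₀ ℕ) (a : LaurentSeries k[X])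
    (x : LaurentSeries (MvPowerSeries ℕ+ k)[X]) :
    laurentCoeff μ (laurentMap (inclT k) a * x) = a * laurentCoeff μ x := by
  ext1
  ext1 n
  have h1 : (laurentMap (inclT k) a).support ⊆ a.support := fun i hi h0 => hi (by
    change inclT k (a.coeff i) = 0
    rw [h0, map_zero])
  have h2 : (laurentCoeff μ x).support ⊆ x.support := fun i hi h0 => hi (by
    change monomialCoeff μ (x.coeff i) = 0
    rw [h0, map_zero])
  rw [coeff_laurentCoeff, HahnSeries.coeff_mul_left' a.isPWO_support h1,
    HahnSeries.coeff_mul_right' x.isPWO_support h2, map_sum]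
  exact Finset.sum_congr rfl fun ij _ => monomialCoeff_map_C_mul μ _ _

lemma card_idx_nil (μ : ℕ+ →₀ ℕ) : (Nat.card (Idx [] μ) : k) = if μ = 0 then 1 else 0 := by
  rw [← coeff_truncQSym_of_isLeftWeak isLeftWeak_nil (le_refl (top μ)), truncQSym,
    chainSum_nil_right, MvPolynomial.coeff_one]
  simp [eq_comm]

variable [Algebra ℚ k]

lemma ofPowerSeries_expTZ (b : ℕ) :
    HahnSeries.ofPowerSeries ℤ _ (expTZ k b) = laurentMap (inclT k)
      (HahnSeries.ofPowerSeries ℤ _ (expS ((b : k[X]) * Polynomial.X))) := by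
  rw [laurentMap_ofPowerSeries]
  congr 1
  ext1 n
  rw [PowerSeries.coeff_map, coeff_expS, expTZ, PowerSeries.coeff_mk]
  have h : algebraMap ℚ k[X] (1 / n.factorial) =
    Polynomial.C (algebraMap ℚ k (1 / n.factorial)) := rfl
  have h' : algebraMap ℚ (MvPowerSeries ℕ+ k) ((b : ℚ) ^ n / n.factorial) =
    MvPowerSeries.C (algebraMap ℚ k ((b : ℚ) ^ n / n.factorial)) :=
    RingHom.congr_fun (Subsingleton.elim _ (MvPowerSeries.C.comp (algebraMap ℚ k))) _
  rw [h, h', inclT, Polynomial.coe_mapRingHom, Polynomial.map_mul, Polynomial.map_C,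
    Polynomial.map_pow, Polynomial.map_mul, Polynomial.map_natCast, Polynomial.map_X, mul_pow,
    ← Polynomial.C_mul_X_pow_eq_monomial, div_eq_mul_one_div, map_mul (algebraMap ℚ k),
    map_mul MvPowerSeries.C, map_mul Polynomial.C]
  simp only [map_pow, map_natCast]
  ring

/-- The factor `e^(tδz)` occurs once per component. Those of the `m` zeros turn `top μ` into `t +
top μ`; those of `v` go into `E` and do not change its constant term. -/
lemma laurentCoeff_phi (δ : ℕ+) {v : List ℕ} (hv : IsLeftWeak v) (μ : ℕ+ →₀ ℕ) :
    ∃ E : PowerSeries k[X], PowerSeries.constantCoeff E = (Nat.card (Idx v μ) : k[X]) ∧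
      (v = [] → E = PowerSeries.C (Nat.card (Idx v μ) : k[X])) ∧
      ∀ m : ℕ, laurentCoeff μ (phi k ((v ++ List.replicate m 0).map fun a => (a, δ))) =
        HahnSeries.ofPowerSeries ℤ _ E * HahnSeries.ofPowerSeries ℤ _
          (expS (algebraMap ℚ k[X] (δ : ℕ) * (Polynomial.X + (top μ : k[X])))) ^ m *
            prodGeo k[X] (δ : ℕ) m := by
  obtain ⟨E, hE1, hE2, hE3⟩ := exists_laurentExpansion_regCoeff δ hv μ
  have hδ : ((δ : ℕ) : ℚ) ≠ 0 := by exact_mod_cast δ.pos.ne'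
  refine ⟨expS (((v.length * (δ : ℕ) : ℕ) : k[X]) * Polynomial.X) *
    PowerSeries.map (algebraMap ℚ k[X]) E, ?_, ?_, fun m => ?_⟩
  · rw [map_mul, constantCoeff_expS, one_mul, ← PowerSeries.coeff_zero_eq_constantCoeff_apply,
      PowerSeries.coeff_map, PowerSeries.coeff_zero_eq_constantCoeff_apply, hE1, map_natCast]
  · intro h
    rw [hE2 h, h, PowerSeries.map_C, map_natCast]
    simp [expS_zero]
  · have hphi : laurentCoeff μ (phiZero k ((v ++ List.replicate m 0).map fun a => (a, δ))) =
        laurentMap (algebraMap ℚ k[X])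
          (laurentExpansion (regCoeff ((v ++ List.replicate m 0).map fun a => (a, δ)) μ)) := by
      ext1
      ext1 n
      rw [coeff_laurentCoeff, coeff_laurentMap]
      set w := (v ++ List.replicate m 0).map fun a => (a, δ) with hw
      have hlen : w.length = v.length + m := by simp [hw]
      change monomialCoeff μ (if -(w.length : ℤ) ≤ n then Polynomial.C
        (fun μ => algebraMap ℚ k ((laurentExpansion (regCoeff w μ)).coeff n)) else 0) = _
      split_ifs with h
      · exact monomialCoeff_C μ _
      -- Below the cut-off of `phiZero` the true coefficient is zero, as the pole order is at most
      -- `m`.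
      · rw [map_zero, hE3, coeff_mul_eq_zero (a := 0) (b := -m)
          (fun n hn => by rw [← map_pow, ← map_mul, coeff_ofPowerSeries_of_neg _ hn])
          (fun n hn => coeff_prodGeo _ m hn) (by omega), map_zero]
    have hsum : (((v ++ List.replicate m 0).map fun a => (a, δ)).map
        fun p : ℕ × ℕ+ => (p.2 : ℕ)).sum = v.length * δ + m * δ := by
      simp [Function.comp_def, add_mul]
    rw [phi, ofPowerSeries_expTZ, laurentCoeff_mul, hphi, hE3, map_mul, map_mul, map_pow,
      laurentMap_prodGeo _ hδ, laurentMap_ofPowerSeries, laurentMap_ofPowerSeries, map_expS, hsum,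
      Nat.cast_add, add_mul, expS_add, mul_add, expS_add, Nat.cast_mul m, mul_assoc (m : k[X]),
      ← expS_pow (((δ : ℕ) : k[X]) * Polynomial.X)]
    simp only [map_mul, map_pow, map_natCast, mul_pow]
    ring

variable (k) in
/-- The value of `φ₋` on a weak composition in the direction `(δ, …, δ)`. -/
def counterterm (δ : ℕ+) (α : List ℕ) : LaurentSeries (MvPowerSeries ℕ+ k)[X] :=
  if ∀ a ∈ α, a = 0 then polarSeq _ (δ : ℕ) α.length else 0

variable (k) in
/-- The value of `φ₊` on a weak composition in the direction `(δ, …, δ)`. -/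
def renormalizedSum (δ : ℕ+) (α : List ℕ) : LaurentSeries (MvPowerSeries ℕ+ k)[X] :=
  ∑ i ∈ Finset.range (α.length + 1),
    phi k ((α.take i).map fun a => (a, δ)) * counterterm k δ (α.drop i)

/-- A suffix that begins inside `v` contains the positive last component of `v`, so its counterterm
is 0. -/
lemma renormalizedSum_append (δ : ℕ+) {v : List ℕ} (hv : IsLeftWeak v) (m : ℕ) :
    renormalizedSum k δ (v ++ List.replicate m 0) = ∑ j ∈ Finset.range (m + 1),
      phi k ((v ++ List.replicate j 0).map fun a => (a, δ)) * polarSeq _ (δ : ℕ) (m - j) := by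
  rw [renormalizedSum, List.length_append, List.length_replicate, add_assoc,
    Finset.sum_range_add, Finset.sum_eq_zero, zero_add]
  · refine Finset.sum_congr rfl fun j hj => ?_
    have hj := Finset.mem_range.1 hj
    rw [List.take_append, List.take_of_length_le (by omega), Nat.add_sub_cancel_left,
      List.take_replicate, List.drop_append, List.drop_eq_nil_of_le (by omega),
      Nat.add_sub_cancel_left, List.drop_replicate, List.nil_append, counterterm, if_pos,
      List.length_replicate, min_eq_left (by omega)]
    intro a ha
    exact List.eq_of_mem_replicate ha
  · intro i hi
    have hi := Finset.mem_range.1 hi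
    rw [counterterm, if_neg, mul_zero]
    intro h
    have hne : v ≠ [] := by
      rintro rfl
      simp at hi
    refine absurd (h (v.getLast hne) ?_) (hv hne).ne'
    rw [List.drop_append]
    refine List.mem_append_left _ ?_
    have hd : v.drop i ≠ [] := by simpa using hi
    rw [← List.getLast_drop hd]
    exact List.getLast_mem hd

/-- The pole cancellation is applied over `k[t]` with `s = t + top μ`. -/
lemma laurentCoeff_renormalizedSum (δ : ℕ+) {v : List ℕ} (hv : IsLeftWeak v) (m : ℕ)
    (μ : ℕ+ →₀ ℕ) : ∃ h : PowerSeries k[X],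
      laurentCoeff μ (renormalizedSum k δ (v ++ List.replicate m 0)) =
        HahnSeries.ofPowerSeries ℤ _ h ∧
      PowerSeries.constantCoeff h =
        (Nat.card (Idx v μ) : k[X]) * chooseQ (shiftedT k - (top μ : k[X])) m := by
  have hδ : ((δ : ℕ) : ℚ) ≠ 0 := by exact_mod_cast δ.pos.ne'
  obtain ⟨E, hE1, -, hE3⟩ := laurentCoeff_phi (k := k) δ hv μ
  obtain ⟨h, h1, h2⟩ := exists_sum_prodGeo_mul_polarSeq hδ (Polynomial.X + (top μ : k[X])) m
  refine ⟨E * h, ?_, ?_⟩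
  · rw [renormalizedSum_append δ hv, map_sum, map_mul, ← h1, Finset.mul_sum]
    refine Finset.sum_congr rfl fun j _ => ?_
    rw [← laurentMap_polarSeq (inclT k), mul_comm (phi k _), laurentCoeff_mul, hE3]
    ring
  · rw [map_mul, hE1, h2]
    congr 2
    have : algebraMap ℚ k[X] (1 / 2) = Polynomial.C (algebraMap ℚ k (1 / 2)) := rfl
    rw [shiftedT, this]
    ring

lemma coeff_renormalizedSum_of_neg (δ : ℕ+) (α : List ℕ) {n : ℤ} (hn : n < 0) :
    (renormalizedSum k δ α).coeff n = 0 := by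
  obtain ⟨v, m, hv, rfl⟩ := exists_eq_append_replicate α
  refine ext_monomialCoeff fun μ => ?_
  obtain ⟨h, h1, -⟩ := laurentCoeff_renormalizedSum (k := k) δ hv m μ
  rw [← coeff_laurentCoeff, h1, coeff_ofPowerSeries_of_neg _ hn, map_zero]

lemma coeff_counterterm (δ : ℕ+) (a : ℕ) (α : List ℕ) {n : ℤ} (hn : 0 ≤ n) :
    (counterterm k δ (a :: α)).coeff n = 0 := by
  rw [counterterm]
  split_ifs
  · exact coeff_polarSeq _ _ hn
  · rfl

lemma phi_nil : phi k [] = 1 := by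
  refine ext_laurentCoeff fun μ => ?_
  obtain ⟨E, -, hE2, hE3⟩ := laurentCoeff_phi (k := k) 1 isLeftWeak_nil μ
  have h := hE3 0
  rw [hE2 rfl, pow_zero, mul_one, prodGeo, Finset.prod_range_zero, mul_one,
    HahnSeries.ofPowerSeries_C] at h
  refine Eq.trans h ?_
  ext1
  ext1 n
  rw [coeff_laurentCoeff, HahnSeries.C_apply, HahnSeries.coeff_single, HahnSeries.coeff_one]
  split_ifs with h0
  · rw [← Polynomial.C_1, monomialCoeff_C, MvPowerSeries.coeff_one, ← card_idx_nil,
      map_natCast]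
  · rw [map_zero]

lemma counterterm_nil (δ : ℕ+) : counterterm k δ [] = 1 := by
  rw [counterterm, if_pos (by simp)]
  exact polarSeq_zero _

lemma renormalizedSum_cons (δ : ℕ+) (a : ℕ) (α : List ℕ) :
    renormalizedSum k δ (a :: α) = counterterm k δ (a :: α) +
      (phi k ((a :: α).map fun a => (a, δ)) + ∑ i : Fin α.length,
        phi k ((a, δ) :: (α.map fun a => (a, δ)).take i) * counterterm k δ (α.drop i)) := by
  rw [renormalizedSum, Finset.sum_range_succ', List.length_cons, Finset.sum_range_succ]
  simp only [List.take_zero, List.map_nil, phi_nil, one_mul, List.drop_zero, List.take_succ_cons,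
    List.drop_succ_cons, List.take_length, List.drop_length, counterterm_nil, mul_one,
    List.map_cons, List.map_take]
  rw [Finset.sum_range fun i => phi k ((a, δ) :: (α.map fun a => (a, δ)).take i) *
    counterterm k δ (α.drop i)]
  ring

/-- The first series has no pole, and the counterterm of a nonempty word has nothing but a polar
part. -/
lemma polar_renormalizedSum_sub (δ : ℕ+) (a : ℕ) (α : List ℕ) :
    polar (renormalizedSum k δ (a :: α) - counterterm k δ (a :: α)) =
      -counterterm k δ (a :: α) := by
  ext1
  ext1 n
  rw [polar, HahnSeries.coeff_truncLT, HahnSeries.coeff_sub, HahnSeries.coeff_neg]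
  split_ifs with h
  · rw [coeff_renormalizedSum_of_neg δ _ h, zero_sub]
  · rw [coeff_counterterm δ a α (not_lt.1 h), neg_zero]

lemma phi_add_sum_mul_counterterm (δ : ℕ+) (a : ℕ) (α : List ℕ) :
    phi k ((a, δ) :: α.map fun a => (a, δ)) + ∑ i : Fin (α.map fun a => (a, δ)).length,
        phi k ((a, δ) :: (α.map fun a => (a, δ)).take i) * counterterm k δ (α.drop i) =
      renormalizedSum k δ (a :: α) - counterterm k δ (a :: α) := by
  refine (add_sub_cancel_left (counterterm k δ (a :: α)) _).symm.trans ?_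
  rw [renormalizedSum_cons, List.map_cons]
  congr 3
  let f : ℕ → LaurentSeries (MvPowerSeries ℕ+ k)[X] := fun i =>
    phi k ((a, δ) :: (α.map fun a => (a, δ)).take i) * counterterm k δ (α.drop i)
  exact (Finset.sum_range f).symm.trans (by rw [List.length_map, Finset.sum_range f])

/-- By induction on the length, the series whose polar part defines `phiMinus` is the renormalized
sum without its counterterm, so its polar part is minus the counterterm. -/
lemma phiMinus_map (δ : ℕ+) (α : List ℕ) :
    phiMinus k (α.map fun a => (a, δ)) = counterterm k δ α := by
  induction hn : α.length using Nat.strong_induction_on generalizing α with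
  | _ n ih =>
  cases α with
  | nil => rw [List.map_nil, phiMinus, counterterm_nil]
  | cons a α =>
    have h : ∀ i : ℕ, phiMinus k ((α.map fun a => (a, δ)).drop i) =
        counterterm k δ (α.drop i) := by
      intro i
      rw [← List.map_drop]
      refine ih _ ?_ _ rfl
      rw [← hn, List.length_drop, List.length_cons]
      omega
    rw [List.map_cons, phiMinus]
    simp only [h]
    rw [phi_add_sum_mul_counterterm, polar_renormalizedSum_sub, neg_neg]

lemma phiPlus_map (δ : ℕ+) (α : List ℕ) :
    phiPlus k (α.map fun a => (a, δ)) = renormalizedSum k δ α := by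
  cases α with
  | nil => simp [phiPlus, renormalizedSum, phi_nil, counterterm_nil]
  | cons a α =>
    rw [List.map_cons, phiPlus]
    simp only [← List.map_drop, phiMinus_map]
    rw [phi_add_sum_mul_counterterm, polar_renormalizedSum_sub]
    ring

theorem isRenormalized_renQSym (δ : ℕ+) : IsRenormalized (renQSym k δ) := by
  intro v m μ hv
  obtain ⟨h, h1, h2⟩ := laurentCoeff_renormalizedSum (k := k) δ hv m μ
  rw [renQSym, dirQSym, phiPlus_map, ← coeff_laurentCoeff, h1, ← h2,
    ← PowerSeries.coeff_zero_eq_constantCoeff_apply]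
  exact HahnSeries.ofPowerSeries_apply_coeff h 0

end Birkhoff

end WCQSym

end

/-! ### The main theorem -/

theorem mainTheorem9 (k : Type u) [CommRing k] [Nontrivial k] [Algebra ℚ k] :
    -- `Ш(k[x])` is the free commutative Rota-Baxter algebra of weight `1` on the generator `x`
    WCQSym.IsFreeCommRotaBaxter.{u, u, w} (1 : k) (WCQSym.shaP k)
      ((Polynomial.X : Polynomial k) ⊗ₜ[k] (1 : WCQSym.QS k)) ∧
    -- `LWQSym[t, x]` is a subalgebra `S` of `k[[X]][t, x]`
    ∃ S : Subalgebra k (Polynomial (Polynomial (MvPowerSeries ℕ+ k))),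
      Subalgebra.toSubmodule S = WCQSym.LWQSymTX k ∧
      -- an algebra isomorphism, and the Rota-Baxter operator that it induces
      ∃ (e : WCQSym.Sha k ≃ₐ[k] S) (P : S →ₗ[k] S) (B : Module.Basis (ℕ × List ℕ) k S),
        WCQSym.IsRotaBaxter (1 : k) P ∧
        (∀ s : WCQSym.Sha k, e (WCQSym.shaP k s) = P (e s)) ∧
        -- `x ^ n M_α` is a basis of `LWQSym[t, x]`
        (∀ (δ : ℕ+) (n : ℕ) (α : List ℕ),
          (B (n, α) : Polynomial (Polynomial (MvPowerSeries ℕ+ k))) =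
            Polynomial.X ^ n * Polynomial.C (WCQSym.renQSym k δ α)) ∧
        (∀ (n : ℕ) (α : List ℕ),
          e ((Polynomial.X ^ n : Polynomial k) ⊗ₜ[k] WCQSym.QS.word α) = B (n, α)) ∧
        -- the operator sends `x ^ n M_α` to `M_{(n) · α}`
        (∀ (δ : ℕ+) (n : ℕ) (α : List ℕ),
          (P (B (n, α)) : Polynomial (Polynomial (MvPowerSeries ℕ+ k))) =
            Polynomial.C (WCQSym.renQSym k δ (n :: α))) := by
  have hM : ∀ δ, WCQSym.IsRenormalized (WCQSym.renQSym k δ) := WCQSym.isRenormalized_renQSym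
  refine ⟨WCQSym.isFreeCommRotaBaxter_shaP k, ?_⟩
  -- The isomorphism is built with `δ = 1`; `IsRenormalized.ext` transfers the statements to every
  -- `δ`. The operator is `shaP` conjugated by it.
  have hM1 := hM 1
  let e := AlgEquiv.ofInjective (WCQSym.shaExtend hM1.hom)
    (WCQSym.shaExtend_injective hM1.hom_injective)
  have he : ∀ s, (e s : Polynomial (Polynomial (MvPowerSeries ℕ+ k))) =
      WCQSym.shaExtend hM1.hom s := fun s => rfl
  let b := (Polynomial.basisMonomials k).tensorProduct (WCQSym.wordBasis k)
  have hb : ∀ n α, b (n, α) = (Polynomial.X ^ n : Polynomial k) ⊗ₜ[k] WCQSym.QS.word α := by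
    intro n α
    rw [Module.Basis.tensorProduct_apply, Polynomial.coe_basisMonomials,
      Polynomial.X_pow_eq_monomial, WCQSym.wordBasis_apply]
  refine ⟨(WCQSym.shaExtend hM1.hom).range, hM1.toSubmodule_range_shaExtend, e,
    e.toLinearMap ∘ₗ WCQSym.shaP k ∘ₗ e.symm.toLinearMap, b.map e.toLinearEquiv, ?_, ?_, ?_, ?_, ?_⟩
  · intro x y
    have h := congrArg e (WCQSym.isRotaBaxter_shaP (e.symm x) (e.symm y))
    simpa using h
  · intro s
    simp
  · intro δ n α
    rw [(hM δ).ext hM1, Module.Basis.map_apply, hb]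
    exact (WCQSym.shaExtend_X_pow_tmul hM1.hom n _).trans (by rw [hM1.hom_word])
  · intro n α
    rw [Module.Basis.map_apply, hb]
    rfl
  · intro δ n α
    rw [(hM δ).ext hM1, Module.Basis.map_apply, hb]
    simp only [LinearMap.comp_apply, AlgEquiv.toLinearMap_apply, AlgEquiv.toLinearEquiv_apply,
      AlgEquiv.symm_apply_apply, he]
    rw [WCQSym.shaP_tmul, ← pow_zero Polynomial.X, WCQSym.shaExtend_X_pow_tmul hM1.hom,
      hM1.hom_word, pow_zero, one_mul]
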